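/- Let $k$ be a field, let $H$ be a Hopf algebra over $k$ with coproduct $\triangle$ and counit $\epsilon$, and write $\otimes=\otimes_k$. Let $A=\bigoplus_{i\ge 0}A_i$ be a connected ($A_0=k\cdot 1\neq 0$) $\mathbb{N}$-graded $k$-algebra with all $A_i$ finite-dimensional, and suppose that $A$ is an $H$-module algebra, that is, $h\rhd(ab)=m(\triangle(h)\rhd(a\otimes b))$ and $h\rhd 1=\epsilon(h)1$, where $m$ is the product of $A$, and that $H$ acts by degree-preserving endomorphisms: $h\rhd A_i\subseteq A_i$ for all $h\in H$ and $i\ge 0$. Put $V=A_1$, and suppose that $A=T(V)/(R)$ for a subspace $R\subseteq V\otimes V$, that is, the algebra map $T(V)\to A$ extending the inclusion of $V$ is surjective and its kernel is the two-sided ideal generated by $R$. A connected $\mathbb{N}$-graded algebra $B$ with finite-dimensional components is called Koszul if $k$, as a left $B$-module via the augmentation $B\to B/\bigoplus_{i>0}B_i=k$, has a linear graded free resolution, that is, an exact sequence $\cdots\to P_2\to P_1\to P_0\to k\to 0$ of graded left $B$-modules and degree-preserving $B$-linear maps in which each $P_n$ is free on a set of homogeneous elements of degree $n$. Let $\mu\in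 H\otimes H$ be a counital $2$-cocycle, that is, an invertible element with $(\mu\otimes 1)\cdot(\triangle\otimes\mathrm{id})(\mu)=(1\otimes\mu)\cdot(\mathrm{id}\otimes\triangle)(\mu)$ and $(\epsilon\otimes\mathrm{id})(\mu)=1=(\mathrm{id}\otimes\epsilon)(\mu)$. The Drinfeld twist $A_\mu$ is the algebra with the same underlying graded vector space and unit as $A$ and with product $m_\mu(a\otimes b)=m(\mu^{-1}\rhd(a\otimes b))$. If $A$ is Koszul, then $A_\mu$, with the grading of $A$, is also Koszul, and $A_\mu=T(V)/(R_\mu)$ with $R_\mu=\{\mu\rhd r\mid r\in R\}\subseteq V\otimes V$; that is, the algebra map $T(V)\to A_\mu$ extending the inclusion of $V$ is surjective and its kernel is the two-sided ideal generated by $R_\mu$. -/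

import Mathlib

open scoped TensorProduct

noncomputable section

namespace KoszulTwist

universe u v w

section Actions

variable {k : Type u} [Field k]

/-- If `H` acts on `M` and `K` acts on `N`, then `H ⊗ K` acts on `M ⊗ N` by
`(h ⊗ g) ▷ (m ⊗ n) = (h ▷ m) ⊗ (g ▷ n)`. -/
def tensorAction {H K M N : Type*} [Ring H] [Algebra k H] [Ring K] [Algebra k K]
    [AddCommGroup M] [Module k M] [AddCommGroup N] [Module k N]
    (ρ : H →ₐ[k] Module.End k M) (σ : K →ₐ[k] Module.End k N) :
    (H ⊗[k] K) →ₐ[k] Module.End k (M ⊗[k] N) :=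
  Module.endTensorEndAlgHom.comp (Algebra.TensorProduct.map ρ σ)

theorem tensorAction_tmul {H K M N : Type*} [Ring H] [Algebra k H] [Ring K] [Algebra k K]
    [AddCommGroup M] [Module k M] [AddCommGroup N] [Module k N]
    (ρ : H →ₐ[k] Module.End k M) (σ : K →ₐ[k] Module.End k N) (h : H) (g : K) (m : M) (n : N) :
    tensorAction ρ σ (h ⊗ₜ g) (m ⊗ₜ n) = ρ h m ⊗ₜ σ g n := rfl

/-- The representation of `H` on a subspace `W` of an `H`-module that is stable under `H`. -/
def restrictedAction {H A : Type*} [Ring H] [Algebra k H] [AddCommGroup A] [Module k A]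
    [Module H A] [IsScalarTower k H A] (W : Submodule k A)
    (hW : ∀ (h : H), ∀ a ∈ W, h • a ∈ W) : H →ₐ[k] Module.End k W where
  toFun h := (Algebra.lsmul k k A h).restrict (hW h)
  map_one' := by ext; simp
  map_mul' x y := by ext z; exact mul_smul x y (z : A)
  map_zero' := by ext; simp
  map_add' x y := by ext z; exact add_smul x y (z : A)
  commutes' r := by ext; simp

theorem restrictedAction_coe {H A : Type*} [Ring H] [Algebra k H] [AddCommGroup A] [Module k A]
    [Module H A] [IsScalarTower k H A] (W : Submodule k A)
    (hW : ∀ (h : H), ∀ a ∈ W, h • a ∈ W) (h : H) (x : W) :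
    ((restrictedAction W hW h x : W) : A) = h • (x : A) := rfl

end Actions

section Twist

/-- An algebra `A` with a `k`-linear action of the Hopf algebra `H` is an `H`-module algebra:
`h ▷ (a b) = m (Δ(h) ▷ (a ⊗ b))` and `h ▷ 1 = ε(h) 1`. -/
class IsModuleAlgebra (k : Type u) (H : Type w) (A : Type v) [Field k] [Ring H] [HopfAlgebra k H]
    [Ring A] [Algebra k A] [Module H A] [IsScalarTower k H A] : Prop where
  smul_mul_eq : ∀ (h : H) (a b : A), h • (a * b) =
    LinearMap.mul' k A (tensorAction (Algebra.lsmul k k A) (Algebra.lsmul k k A)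
      (Coalgebra.comul (R := k) h) (a ⊗ₜ[k] b))
  smul_one_eq : ∀ h : H, h • (1 : A) = (Coalgebra.counit (R := k) h : k) • (1 : A)

/-- A counital `2`-cocycle of the Hopf algebra `H`: an invertible `μ ∈ H ⊗ H` with
`(μ ⊗ 1) · (Δ ⊗ id)(μ) = (1 ⊗ μ) · (id ⊗ Δ)(μ)` and `(ε ⊗ id)(μ) = 1 = (id ⊗ ε)(μ)`. -/
structure CounitalTwoCocycle (k : Type u) (H : Type w) [Field k] [Ring H] [HopfAlgebra k H] where
  val : (H ⊗[k] H)ˣ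
  cocycle : Algebra.TensorProduct.assoc k k k H H H
      (((val : H ⊗[k] H) ⊗ₜ[k] (1 : H)) *
        LinearMap.rTensor H (Coalgebra.comul (R := k) (A := H)) (val : H ⊗[k] H)) =
    ((1 : H) ⊗ₜ[k] (val : H ⊗[k] H)) *
        LinearMap.lTensor H (Coalgebra.comul (R := k) (A := H)) (val : H ⊗[k] H)
  counit_left : TensorProduct.lid k H
    (LinearMap.rTensor H (Coalgebra.counit (R := k) (A := H)) (val : H ⊗[k] H)) = 1
  counit_right : TensorProduct.rid k H
    (LinearMap.lTensor H (Coalgebra.counit (R := k) (A := H)) (val : H ⊗[k] H)) = 1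

variable {k : Type u} {H : Type w} [Field k] [Ring H] [HopfAlgebra k H]

/-- The underlying space of the Drinfeld twist `A_μ`, equal to that of `A`. -/
@[nolint unusedArguments]
def DrinfeldTwist (_μ : CounitalTwoCocycle k H) (A : Type v) : Type v := A

variable (μ : CounitalTwoCocycle k H) {A : Type v} [Ring A] [Algebra k A]

variable [Module H A] [IsScalarTower k H A]

/-- The twisted product `m_μ (a ⊗ b) = m (μ⁻¹ ▷ (a ⊗ b))`. -/
def twistMul (a b : A) : A :=
  LinearMap.mul' k A (tensorAction (Algebra.lsmul k k A) (Algebra.lsmul k k A)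
    (↑(μ.val⁻¹) : H ⊗[k] H) (a ⊗ₜ[k] b))

theorem inv_cocycle : Algebra.TensorProduct.assoc k k k H H H
      (LinearMap.rTensor H (Coalgebra.comul (R := k) (A := H)) (↑(μ.val⁻¹) : H ⊗[k] H) *
        ((↑(μ.val⁻¹) : H ⊗[k] H) ⊗ₜ[k] (1 : H))) =
    LinearMap.lTensor H (Coalgebra.comul (R := k) (A := H)) (↑(μ.val⁻¹) : H ⊗[k] H) *
      ((1 : H) ⊗ₜ[k] (↑(μ.val⁻¹) : H ⊗[k] H)) := by
  let α : (H ⊗[k] H) →ₐ[k] H ⊗[k] (H ⊗[k] H) :=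
    (Algebra.TensorProduct.assoc k k k H H H).toAlgHom.comp Algebra.TensorProduct.includeLeft
  let Φ : (H ⊗[k] H) →ₐ[k] H ⊗[k] (H ⊗[k] H) :=
    (Algebra.TensorProduct.assoc k k k H H H).toAlgHom.comp
      (Algebra.TensorProduct.map (Bialgebra.comulAlgHom k H) (AlgHom.id k H))
  let β : (H ⊗[k] H) →ₐ[k] H ⊗[k] (H ⊗[k] H) := Algebra.TensorProduct.includeRight
  let Ψ : (H ⊗[k] H) →ₐ[k] H ⊗[k] (H ⊗[k] H) :=
    Algebra.TensorProduct.map (AlgHom.id k H) (Bialgebra.comulAlgHom k H)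
  let U (f : (H ⊗[k] H) →ₐ[k] H ⊗[k] (H ⊗[k] H)) : (H ⊗[k] H)ˣ →* (H ⊗[k] (H ⊗[k] H))ˣ :=
    Units.map (f : (H ⊗[k] H) →* H ⊗[k] (H ⊗[k] H))
  have e : U α μ.val * U Φ μ.val = U β μ.val * U Ψ μ.val := by
    apply Units.ext
    have := μ.cocycle
    rw [map_mul] at this
    exact this
  have e2 : U Φ μ.val⁻¹ * U α μ.val⁻¹ = U Ψ μ.val⁻¹ * U β μ.val⁻¹ := by
    have := congrArg (fun x => x⁻¹) e
    simpa only [mul_inv_rev, map_inv] using this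
  have e3 := congrArg Units.val e2
  rw [map_mul]
  exact e3

theorem inv_counit_left : TensorProduct.lid k H
    (LinearMap.rTensor H (Coalgebra.counit (R := k) (A := H)) (↑(μ.val⁻¹) : H ⊗[k] H)) = 1 := by
  let f : (H ⊗[k] H) →ₐ[k] H := (Algebra.TensorProduct.lid k H).toAlgHom.comp
      (Algebra.TensorProduct.map (Bialgebra.counitAlgHom k H) (AlgHom.id k H))
  have h1 : f (μ.val : H ⊗[k] H) = 1 := μ.counit_left
  have h2 : f (μ.val : H ⊗[k] H) * f (↑(μ.val⁻¹) : H ⊗[k] H) = 1 := by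
    rw [← map_mul, Units.mul_inv, map_one]
  rw [h1, one_mul] at h2
  exact h2

theorem inv_counit_right : TensorProduct.rid k H
    (LinearMap.lTensor H (Coalgebra.counit (R := k) (A := H)) (↑(μ.val⁻¹) : H ⊗[k] H)) = 1 := by
  let f : (H ⊗[k] H) →ₐ[k] H := (Algebra.TensorProduct.rid k k H).toAlgHom.comp
      (Algebra.TensorProduct.map (AlgHom.id k H) (Bialgebra.counitAlgHom k H))
  have h1 : f (μ.val : H ⊗[k] H) = 1 := μ.counit_right
  have h2 : f (μ.val : H ⊗[k] H) * f (↑(μ.val⁻¹) : H ⊗[k] H) = 1 := by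
    rw [← map_mul, Units.mul_inv, map_one]
  rw [h1, one_mul] at h2
  exact h2

theorem smul_mul' [IsModuleAlgebra k H A] (h : H) (z : A ⊗[k] A) :
    h • LinearMap.mul' k A z =
    LinearMap.mul' k A (tensorAction (Algebra.lsmul k k A) (Algebra.lsmul k k A)
      (Coalgebra.comul (R := k) h) z) := by
  induction z with
  | zero => simp
  | add x y hx hy => rw [map_add, smul_add, hx, hy, map_add, map_add]
  | tmul a b => exact IsModuleAlgebra.smul_mul_eq h a b

/-- The action of `H ⊗ H` on `A ⊗ A`. -/
abbrev act₂ (k : Type u) (H : Type w) (A : Type v) [Field k] [Ring H] [HopfAlgebra k H]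
    [Ring A] [Algebra k A] [Module H A] [IsScalarTower k H A] :
    (H ⊗[k] H) →ₐ[k] Module.End k (A ⊗[k] A) :=
  tensorAction (Algebra.lsmul k k A) (Algebra.lsmul k k A)

theorem mul_act_left [IsModuleAlgebra k H A] (x y : H ⊗[k] H) (a b c : A) :
    LinearMap.mul' k A (act₂ k H A x ((LinearMap.mul' k A (act₂ k H A y (a ⊗ₜ b))) ⊗ₜ[k] c)) =
    LinearMap.mul' k A (LinearMap.rTensor A (LinearMap.mul' k A)
      (tensorAction (act₂ k H A) (Algebra.lsmul k k A)
        (LinearMap.rTensor H (Coalgebra.comul (R := k) (A := H)) x * (y ⊗ₜ[k] (1 : H)))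
          ((a ⊗ₜ[k] b) ⊗ₜ[k] c))) := by
  induction x with
  | zero => simp
  | add x y hx hy => simp only [map_add, add_mul, LinearMap.add_apply, hx, hy]
  | tmul h g =>
    rw [map_mul, Module.End.mul_apply, tensorAction_tmul, tensorAction_tmul,
      LinearMap.rTensor_tmul, tensorAction_tmul, LinearMap.rTensor_tmul, Algebra.lsmul_coe]
    beta_reduce
    rw [smul_mul', map_one]
    rfl

theorem mul_act_right [IsModuleAlgebra k H A] (x y : H ⊗[k] H) (a b c : A) :
    LinearMap.mul' k A (act₂ k H A x (a ⊗ₜ[k] (LinearMap.mul' k A (act₂ k H A y (b ⊗ₜ c))))) =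
    LinearMap.mul' k A (LinearMap.lTensor A (LinearMap.mul' k A)
      (tensorAction (Algebra.lsmul k k A) (act₂ k H A)
        (LinearMap.lTensor H (Coalgebra.comul (R := k) (A := H)) x * ((1 : H) ⊗ₜ[k] y))
          (a ⊗ₜ[k] (b ⊗ₜ[k] c)))) := by
  induction x with
  | zero => simp
  | add x y hx hy => simp only [map_add, add_mul, LinearMap.add_apply, hx, hy]
  | tmul h g =>
    rw [map_mul, Module.End.mul_apply, tensorAction_tmul, tensorAction_tmul,
      LinearMap.lTensor_tmul, tensorAction_tmul, LinearMap.lTensor_tmul, Algebra.lsmul_coe,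
      map_one, Algebra.lsmul_coe]
    beta_reduce
    rw [smul_mul']
    rfl

theorem tensorAction_assoc (t : (H ⊗[k] H) ⊗[k] H) (a b c : A) :
    LinearMap.lTensor A (LinearMap.mul' k A) (tensorAction (Algebra.lsmul k k A) (act₂ k H A)
      (Algebra.TensorProduct.assoc k k k H H H t) (a ⊗ₜ[k] (b ⊗ₜ[k] c))) =
    LinearMap.lTensor A (LinearMap.mul' k A) (TensorProduct.assoc k A A A
      (tensorAction (act₂ k H A) (Algebra.lsmul k k A) t ((a ⊗ₜ[k] b) ⊗ₜ[k] c))) := by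
  induction t with
  | zero => simp
  | add x y hx hy => simp only [map_add, LinearMap.add_apply, hx, hy]
  | tmul s l =>
    induction s with
    | zero => simp
    | add x y hx hy => simp only [TensorProduct.add_tmul, map_add, LinearMap.add_apply, hx, hy]
    | tmul h g => rfl

theorem mul'_assoc (z : (A ⊗[k] A) ⊗[k] A) :
    LinearMap.mul' k A (LinearMap.lTensor A (LinearMap.mul' k A) (TensorProduct.assoc k A A A z)) =
    LinearMap.mul' k A (LinearMap.rTensor A (LinearMap.mul' k A) z) := by
  induction z with
  | zero => simp
  | add x y hx hy => simp only [map_add, hx, hy]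
  | tmul s c =>
    induction s with
    | zero => simp
    | add x y hx hy => simp only [TensorProduct.add_tmul, map_add, hx, hy]
    | tmul a b => simp [mul_assoc]

theorem twistMul_assoc [IsModuleAlgebra k H A] (a b c : A) :
    twistMul μ (twistMul μ a b) c = twistMul μ a (twistMul μ b c) := by
  unfold twistMul
  rw [mul_act_left, mul_act_right, ← inv_cocycle, tensorAction_assoc, mul'_assoc]

theorem twistMul_one [IsModuleAlgebra k H A] (a : A) : twistMul μ a 1 = a := by
  have key (x : H ⊗[k] H) : LinearMap.mul' k A (act₂ k H A x (a ⊗ₜ 1)) =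
      TensorProduct.rid k H (LinearMap.lTensor H (Coalgebra.counit (R := k) (A := H)) x) • a := by
    induction x with
    | zero => simp
    | add x y hx hy => simp only [map_add, LinearMap.add_apply, add_smul, hx, hy]
    | tmul h g =>
      rw [tensorAction_tmul, Algebra.lsmul_coe, Algebra.lsmul_coe]
      beta_reduce
      rw [IsModuleAlgebra.smul_one_eq (k := k) g]
      simp
  unfold twistMul
  rw [key, inv_counit_right, one_smul]

theorem one_twistMul [IsModuleAlgebra k H A] (a : A) : twistMul μ 1 a = a := by
  have key (x : H ⊗[k] H) : LinearMap.mul' k A (act₂ k H A x (1 ⊗ₜ a)) =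
      TensorProduct.lid k H (LinearMap.rTensor H (Coalgebra.counit (R := k) (A := H)) x) • a := by
    induction x with
    | zero => simp
    | add x y hx hy => simp only [map_add, LinearMap.add_apply, add_smul, hx, hy]
    | tmul h g =>
      rw [tensorAction_tmul, Algebra.lsmul_coe, Algebra.lsmul_coe]
      beta_reduce
      rw [IsModuleAlgebra.smul_one_eq (k := k) h]
      simp
  unfold twistMul
  rw [key, inv_counit_left, one_smul]

theorem twistMul_add (a b c : A) : twistMul μ a (b + c) = twistMul μ a b + twistMul μ a c := by
  simp only [twistMul, TensorProduct.tmul_add, map_add]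

theorem add_twistMul (a b c : A) : twistMul μ (a + b) c = twistMul μ a c + twistMul μ b c := by
  simp only [twistMul, TensorProduct.add_tmul, map_add]

theorem smul_twistMul (r : k) (a b : A) : twistMul μ (r • a) b = r • twistMul μ a b := by
  simp only [twistMul, ← TensorProduct.smul_tmul', map_smul]

theorem twistMul_smul (r : k) (a b : A) : twistMul μ a (r • b) = r • twistMul μ a b := by
  simp only [twistMul, TensorProduct.tmul_smul, map_smul]

theorem zero_twistMul (a : A) : twistMul μ 0 a = 0 := by simp [twistMul]

theorem twistMul_zero (a : A) : twistMul μ a 0 = 0 := by simp [twistMul]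

theorem smul_eq_twistMul [IsModuleAlgebra k H A] (r : k) (a : A) :
    r • a = twistMul μ (r • (1 : A)) a := by
  rw [smul_twistMul, one_twistMul]

theorem algebraMap_twistMul_comm [IsModuleAlgebra k H A] (r : k) (a : A) :
    twistMul μ (r • (1 : A)) a = twistMul μ a (r • (1 : A)) := by
  rw [smul_twistMul, twistMul_smul, one_twistMul, twistMul_one]

/-- The ring `A_μ`: the additive group and the unit of `A`, and the product `m_μ`. -/
instance [IsModuleAlgebra k H A] : Ring (DrinfeldTwist μ A) where
  __ := (inferInstanceAs (AddCommGroup A) : AddCommGroup (DrinfeldTwist μ A))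
  mul a b := twistMul μ (A := A) a b
  one := (1 : A)
  mul_assoc := twistMul_assoc μ (A := A)
  one_mul := one_twistMul μ (A := A)
  mul_one := twistMul_one μ (A := A)
  left_distrib := twistMul_add μ (A := A)
  right_distrib := add_twistMul μ (A := A)
  zero_mul := zero_twistMul μ (A := A)
  mul_zero := twistMul_zero μ (A := A)

/-- The `k`-algebra `A_μ`, with the scalar multiplication of `A`. -/
instance [IsModuleAlgebra k H A] : Algebra k (DrinfeldTwist μ A) where
  smul := fun (r : k) (a : A) => r • a
  algebraMap :=
    { toFun := fun r => (r • (1 : A) : A)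
      map_one' := one_smul k (1 : A)
      map_mul' := fun r s => by
        change (r * s) • (1 : A) = twistMul μ (r • (1 : A)) (s • (1 : A))
        rw [smul_twistMul, twistMul_smul, one_twistMul, mul_smul]
      map_zero' := zero_smul k (1 : A)
      map_add' := fun r s => add_smul r s (1 : A) }
  commutes' := algebraMap_twistMul_comm μ (A := A)
  smul_def' := smul_eq_twistMul μ (A := A)

/-- The identity map `A → A_μ`. -/
def toTwist [IsModuleAlgebra k H A] : A ≃ₗ[k] DrinfeldTwist μ A where
  toFun a := a
  invFun a := a
  map_add' _ _ := rfl
  map_smul' _ _ := rfl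
  left_inv _ := rfl
  right_inv _ := rfl

theorem toTwist_mul [IsModuleAlgebra k H A] (a b : A) :
    toTwist μ a * toTwist μ b = toTwist μ (twistMul μ a b) := rfl

/-- The grading of `A_μ`, the same as that of `A`. -/
def twistGrading [IsModuleAlgebra k H A] (𝒜 : ℕ → Submodule k A) :
    ℕ → Submodule k (DrinfeldTwist μ A) :=
  fun i => (𝒜 i).map (toTwist μ).toLinearMap

end Twist

section Koszul

variable {k : Type u} [Field k] {B : Type v} [Ring B] [Algebra k B]

/-- `B = ⨁ 𝒜 i` is a connected `ℕ`-graded, locally finite-dimensional `k`-algebra. -/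
structure IsConnectedGraded (𝒜 : ℕ → Submodule k B) : Prop where
  isInternal : DirectSum.IsInternal 𝒜
  mul_mem : ∀ i j : ℕ, ∀ a ∈ 𝒜 i, ∀ b ∈ 𝒜 j, a * b ∈ 𝒜 (i + j)
  nontrivial : Nontrivial B
  degree_zero : 𝒜 0 = Submodule.span k {(1 : B)}
  finite : ∀ i, FiniteDimensional k (𝒜 i)

/-- `ε' : B → k` is the augmentation map of the graded algebra: it kills `B₊ = ⨁_{i > 0} 𝒜 i`.
(On a connected graded algebra there is exactly one such algebra map, the projection onto
`𝒜 0 = k`.) -/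
def IsAugmentation (𝒜 : ℕ → Submodule k B) (ε' : B →ₐ[k] k) : Prop :=
  ∀ i : ℕ, 0 < i → ∀ a ∈ 𝒜 i, ε' a = 0

/-- The degree `j` component of the graded free left module `⨁_{ι} B(-n)`, whose basis elements
all sit in degree `n`: the vectors with all coordinates in `𝒜 (j - n)` (zero if `j < n`). -/
def freeDegree (𝒜 : ℕ → Submodule k B) (ι : Type v) (n j : ℕ) : Set (ι →₀ B) :=
  {x | ∀ i, if n ≤ j then x i ∈ 𝒜 (j - n) else x i = 0}

/-- A linear graded free resolution of `k` (a left `B`-module through the augmentation `ε'`):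
an exact sequence `⋯ → P₂ → P₁ → P₀ → k → 0` of graded left `B`-modules and degree-preserving
`B`-linear maps, where `P n` is graded free on a basis of elements of degree `n`, and `k` sits in
degree `0`. -/
structure LinearFreeResolution (𝒜 : ℕ → Submodule k B) (ε' : B →ₐ[k] k) where
  ι : ℕ → Type v
  d : ∀ n, (ι (n + 1) →₀ B) →ₗ[B] (ι n →₀ B)
  π : (ι 0 →₀ B) →ₛₗ[(ε' : B →+* k)] k
  d_degree : ∀ n j, ∀ x ∈ freeDegree 𝒜 (ι (n + 1)) (n + 1) j, d n x ∈ freeDegree 𝒜 (ι n) n j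
  π_degree : ∀ j, 0 < j → ∀ x ∈ freeDegree 𝒜 (ι 0) 0 j, π x = 0
  exact_succ : ∀ n, Function.Exact (d (n + 1)) (d n)
  exact_zero : Function.Exact (d 0) π
  surjective : Function.Surjective π

/-- A Koszul algebra: a connected graded, locally finite-dimensional algebra such that `k` has
a linear graded free resolution. -/
def IsKoszul (𝒜 : ℕ → Submodule k B) : Prop :=
  IsConnectedGraded 𝒜 ∧
    ∃ ε' : B →ₐ[k] k, IsAugmentation 𝒜 ε' ∧ Nonempty (LinearFreeResolution 𝒜 ε')

/-- The embedding `V ⊗ V → T(V)`. -/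
def tensorSquare (k : Type u) [Field k] (V : Type v) [AddCommGroup V] [Module k V] :
    V ⊗[k] V →ₗ[k] TensorAlgebra k V :=
  LinearMap.mul' k (TensorAlgebra k V) ∘ₗ
    TensorProduct.map (TensorAlgebra.ι k) (TensorAlgebra.ι k)

/-- `B = T(V)/(R)` by way of the linear map `j : V → B`: the algebra map `T(V) → B` extending `j`
is surjective, and its kernel is the two-sided ideal generated by `R ⊆ V ⊗ V`. -/
def IsQuadraticPresentation {V : Type v} [AddCommGroup V] [Module k V] (j : V →ₗ[k] B)
    (R : Submodule k (V ⊗[k] V)) : Prop :=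
  Function.Surjective (TensorAlgebra.lift k j) ∧
    TwoSidedIdeal.ker (TensorAlgebra.lift k j) =
      TwoSidedIdeal.span (tensorSquare k V '' (R : Set (V ⊗[k] V)))

end Koszul

end KoszulTwist

end

open KoszulTwist

/-!
# Drinfeld twists of Koszul module algebras

**Koszulness.** A linear free resolution of `k` is rigid: if `W n` is the space of generators of
`P n = A ⊗ W n`, then the differential `d n` maps `W (n + 1)` bijectively onto the lowest degree
component of the image of `d n`, since the next term of the resolution starts one degree higher
still. So the action of `H`, trivial on `W 0`, propagates step by step to actions on all `W n` for
which the differentials are equivariant for the diagonal action on `A ⊗ W n`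
(`LinearFreeResolution.exists_equivariant`). An equivariant `A`-module becomes an `A_μ`-module
through `a, p ↦ m(μ⁻¹ ▷ (a ⊗ p))`, equivariant `A`-linear maps become `A_μ`-linear, and the inverse
cocycle identity says exactly that `x ↦ μ⁻¹ ▷ x` is an `A_μ`-linear isomorphism from the free module
`A_μ ⊗ W` to the twist of `A ⊗ W` (`twistFree_smul`). Conjugating the differentials by these
isomorphisms changes neither exactness nor degrees (`LinearFreeResolution.twist`).

**Relations.** The action on `V` extends to `T(V)`, which becomes an `H`-module algebra; the map
`t ↦ (h ↦ h ▷ t)` is the algebra map from `T(V)` to the convolution algebra `Hom(H, T(V))` determined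
by the action on `V`. Since `μ` is invertible, a product of two `H`-stable subspaces is the same in
`T(V)` and in its twist (`map_toTwist_mul`). Consequently the canonical map `Ψ` from `T(V)` to
`T(V)_μ` is onto in each degree, hence bijective (`toTwistTensorAlgebra_bijective`). Moreover `R`,
being the degree two part of the `H`-stable kernel of `T(V) → A`, is `H`-stable, so the ideals
`T(V) R T(V)` of `T(V)` and of `T(V)_μ` coincide. The inverse image of this ideal under `Ψ` is
generated by `μ ▷ R`, because `Ψ` sends `μ ▷ r` to `r` (`toTwistTensorAlgebra_tensorSquare`).
-/

open scoped TensorProduct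

noncomputable section

namespace KoszulTwist

universe u v w

/-! ### Free modules over a module algebra -/

section FreeModules

variable {k : Type u} [Field k] {H : Type w} [Ring H] [HopfAlgebra k H]
variable {A : Type v} [Ring A] [Algebra k A]

/-- The scalar multiplication `A ⊗ P → P` of an `A`-module `P`. -/
def smulMap (k : Type u) [Field k] (A : Type v) [Ring A] [Algebra k A] (P : Type*)
    [AddCommGroup P] [Module k P] [Module A P] [IsScalarTower k A P] : A ⊗[k] P →ₗ[k] P :=
  TensorProduct.lift (Algebra.lsmul k k P : A →ₐ[k] Module.End k P).toLinearMap

@[simp]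
theorem smulMap_tmul {P : Type*} [AddCommGroup P] [Module k P] [Module A P] [IsScalarTower k A P]
    (a : A) (p : P) : smulMap k A P (a ⊗ₜ p) = a • p := rfl

/-- The diagonal action of `H` obtained from an action of `H ⊗ H`. -/
def diagAction {P : Type*} [AddCommGroup P] [Module k P]
    (τ : H ⊗[k] H →ₐ[k] Module.End k P) : H →ₐ[k] Module.End k P :=
  τ.comp (Bialgebra.comulAlgHom k H)

theorem diagAction_apply {P : Type*} [AddCommGroup P] [Module k P]
    (τ : H ⊗[k] H →ₐ[k] Module.End k P) (h : H) :
    diagAction τ h = τ (Coalgebra.comul (R := k) h) := rfl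

variable {ι : Type*}

/-- The inclusion `W → A ⊗ W`, `w ↦ 1 ⊗ w`, where `W = k^(ι)` and `A ⊗ W` is written as the free
module `A^(ι)`. -/
def genMap (k : Type u) [Field k] (A : Type v) [Ring A] [Algebra k A] (ι : Type*) :
    (ι →₀ k) →ₗ[k] (ι →₀ A) :=
  Finsupp.mapRange.linearMap (Algebra.linearMap k A)

theorem genMap_apply (w : ι →₀ k) (i : ι) : genMap k A ι w i = algebraMap k A (w i) := by
  simp [genMap]

open Classical in
/-- The identification of `A ⊗ k^(ι)` with the free module `A^(ι)`. -/
def freeEquiv (k : Type u) [Field k] (A : Type v) [Ring A] [Algebra k A] (ι : Type*) :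
    A ⊗[k] (ι →₀ k) ≃ₗ[k] (ι →₀ A) :=
  TensorProduct.finsuppScalarRight k k A ι

theorem freeEquiv_tmul (a : A) (w : ι →₀ k) :
    freeEquiv k A ι (a ⊗ₜ w) = a • genMap k A ι w := by
  ext i
  simp [freeEquiv, genMap_apply, Algebra.smul_def, Algebra.commutes]

theorem single_eq_smul_genMap (i : ι) (a : A) :
    Finsupp.single i a = a • genMap k A ι (Finsupp.single i 1) := by
  simp [genMap]

variable [Module H A] [IsScalarTower k H A]

/-- The action of `H ⊗ H` on the free module `A^(ι) = A ⊗ k^(ι)`, where the second factor acts on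
`k^(ι)` through `ρ`. -/
def freeAct (A : Type v) [Ring A] [Algebra k A] [Module H A] [IsScalarTower k H A]
    (ρ : H →ₐ[k] Module.End k (ι →₀ k)) : H ⊗[k] H →ₐ[k] Module.End k (ι →₀ A) :=
  ((freeEquiv k A ι).conjAlgEquiv k).toAlgHom.comp
    (tensorAction (Algebra.lsmul k k A) ρ)

variable (ρ : H →ₐ[k] Module.End k (ι →₀ k))

theorem freeAct_smul_genMap' (x : H ⊗[k] H) (a : A) (w : ι →₀ k) :
    freeAct A ρ x (a • genMap k A ι w) = freeEquiv k A ι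
      (tensorAction (Algebra.lsmul k k A) ρ x (a ⊗ₜ w)) := by
  rw [← freeEquiv_tmul]
  simp [freeAct, LinearEquiv.conjAlgEquiv_apply]

theorem freeAct_smul_genMap (h g : H) (a : A) (w : ι →₀ k) :
    freeAct A ρ (h ⊗ₜ g) (a • genMap k A ι w) = (h • a) • genMap k A ι (ρ g w) := by
  rw [freeAct_smul_genMap', tensorAction_tmul, freeEquiv_tmul]
  rfl

theorem freeAct_mul_left [IsModuleAlgebra k H A] (x y : H ⊗[k] H) (a b : A) (w : ι →₀ k) :
    freeAct A ρ x (LinearMap.mul' k A (act₂ k H A y (a ⊗ₜ b)) • genMap k A ι w) =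
    freeEquiv k A ι (LinearMap.rTensor (ι →₀ k) (LinearMap.mul' k A)
      (tensorAction (act₂ k H A) ρ
        (LinearMap.rTensor H (Coalgebra.comul (R := k) (A := H)) x * (y ⊗ₜ[k] (1 : H)))
          ((a ⊗ₜ[k] b) ⊗ₜ[k] w))) := by
  induction x with
  | zero => simp
  | add x y hx hy => simp only [map_add, add_mul, LinearMap.add_apply, hx, hy]
  | tmul h g =>
    rw [map_mul, Module.End.mul_apply, tensorAction_tmul, freeAct_smul_genMap,
      LinearMap.rTensor_tmul, tensorAction_tmul, LinearMap.rTensor_tmul, smul_mul', map_one,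
      freeEquiv_tmul]
    rfl

theorem freeAct_mul_right (x y : H ⊗[k] H) (a b : A) (w : ι →₀ k) :
    smulMap k A (ι →₀ A) (tensorAction (Algebra.lsmul k k A) (diagAction (freeAct A ρ)) x
      (a ⊗ₜ freeAct A ρ y (b • genMap k A ι w))) =
    smulMap k A (ι →₀ A) (LinearMap.lTensor A
      (freeEquiv k A ι).toLinearMap
      (tensorAction (Algebra.lsmul k k A) (tensorAction (Algebra.lsmul k k A) ρ)
        (LinearMap.lTensor H (Coalgebra.comul (R := k) (A := H)) x * ((1 : H) ⊗ₜ[k] y))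
          (a ⊗ₜ[k] (b ⊗ₜ[k] w)))) := by
  induction x with
  | zero => simp
  | add x y hx hy => simp only [map_add, add_mul, LinearMap.add_apply, hx, hy]
  | tmul h g =>
    rw [map_mul, Module.End.mul_apply, tensorAction_tmul, tensorAction_tmul,
      LinearMap.lTensor_tmul, tensorAction_tmul, LinearMap.lTensor_tmul, map_one,
      diagAction_apply, ← Module.End.mul_apply, ← map_mul, freeAct_smul_genMap', map_mul]
    rfl

theorem freeAct_assoc (t : (H ⊗[k] H) ⊗[k] H) (a b : A) (w : ι →₀ k) :
    smulMap k A (ι →₀ A) (LinearMap.lTensor A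
      (freeEquiv k A ι).toLinearMap
      (tensorAction (Algebra.lsmul k k A) (tensorAction (Algebra.lsmul k k A) ρ)
        (Algebra.TensorProduct.assoc k k k H H H t) (a ⊗ₜ[k] (b ⊗ₜ[k] w)))) =
    freeEquiv k A ι (LinearMap.rTensor (ι →₀ k) (LinearMap.mul' k A)
      (tensorAction (act₂ k H A) ρ t ((a ⊗ₜ[k] b) ⊗ₜ[k] w))) := by
  induction t with
  | zero => simp
  | add x y hx hy => simp only [map_add, LinearMap.add_apply, hx, hy]
  | tmul s l =>
    induction s with
    | zero => simp
    | add x y hx hy => simp only [TensorProduct.add_tmul, map_add, LinearMap.add_apply, hx, hy]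
    | tmul h g =>
      simp only [Algebra.TensorProduct.assoc_tmul, tensorAction_tmul, LinearMap.lTensor_tmul,
        LinearMap.rTensor_tmul, LinearEquiv.coe_coe, freeEquiv_tmul, smulMap_tmul,
        LinearMap.mul'_apply, mul_smul]

/-- The compatibility of the actions on `A ⊗ A` and on `A^(ι)` given by two elements `x`, `y` of
`H ⊗ H` with `(Δ ⊗ id)(x) (y ⊗ 1) = (id ⊗ Δ)(x) (1 ⊗ y)`. It is used for `x = y = μ⁻¹` and for
`x = Δ(h)`, `y = 1`. -/
theorem freeAct_mul_smul [IsModuleAlgebra k H A] {x y : H ⊗[k] H}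
    (hxy : Algebra.TensorProduct.assoc k k k H H H
        (LinearMap.rTensor H (Coalgebra.comul (R := k) (A := H)) x * (y ⊗ₜ[k] (1 : H))) =
      LinearMap.lTensor H (Coalgebra.comul (R := k) (A := H)) x * ((1 : H) ⊗ₜ[k] y))
    (a b : A) (w : ι →₀ k) :
    freeAct A ρ x (LinearMap.mul' k A (act₂ k H A y (a ⊗ₜ b)) • genMap k A ι w) =
    smulMap k A (ι →₀ A) (tensorAction (Algebra.lsmul k k A) (diagAction (freeAct A ρ)) x
      (a ⊗ₜ freeAct A ρ y (b • genMap k A ι w))) := by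
  rw [freeAct_mul_left, freeAct_mul_right, ← hxy, freeAct_assoc]

/-- The free module `A^(ι)` with the diagonal action is an `H`-equivariant `A`-module. -/
theorem diagAction_smul [IsModuleAlgebra k H A] (h : H) (a : A) (p : ι →₀ A) :
    diagAction (freeAct A ρ) h (a • p) =
    smulMap k A (ι →₀ A) (tensorAction (Algebra.lsmul k k A) (diagAction (freeAct A ρ))
      (Coalgebra.comul (R := k) h) (a ⊗ₜ p)) := by
  induction p using Finsupp.induction_linear with
  | zero => simp
  | add p q hp hq => simp only [smul_add, TensorProduct.tmul_add, map_add, hp, hq]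
  | single i b =>
    have hxy : Algebra.TensorProduct.assoc k k k H H H
        (LinearMap.rTensor H (Coalgebra.comul (R := k) (A := H)) (Coalgebra.comul (R := k) h) *
          ((1 : H ⊗[k] H) ⊗ₜ[k] (1 : H))) =
        LinearMap.lTensor H (Coalgebra.comul (R := k) (A := H)) (Coalgebra.comul (R := k) h) *
          ((1 : H) ⊗ₜ[k] (1 : H ⊗[k] H)) := by
      rw [← Algebra.TensorProduct.one_def, ← Algebra.TensorProduct.one_def, mul_one, mul_one]
      exact Coalgebra.coassoc_apply h
    have := freeAct_mul_smul (A := A) ρ hxy a b (Finsupp.single i 1)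
    rwa [map_one, Module.End.one_apply, LinearMap.mul'_apply, mul_smul, map_one,
      Module.End.one_apply, ← single_eq_smul_genMap] at this

/-- The twisted multiplication of `A` on the free module `A^(ι)`, which `μ⁻¹ ▷` identifies with
the free `A_μ`-module. -/
theorem freeAct_twistMul_smul [IsModuleAlgebra k H A] (μ : CounitalTwoCocycle k H) (a b : A)
    (w : ι →₀ k) :
    freeAct A ρ (↑μ.val⁻¹) (twistMul μ a b • genMap k A ι w) =
    smulMap k A (ι →₀ A) (tensorAction (Algebra.lsmul k k A) (diagAction (freeAct A ρ))
      (↑μ.val⁻¹ : H ⊗[k] H) (a ⊗ₜ freeAct A ρ (↑μ.val⁻¹) (b • genMap k A ι w))) :=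
  freeAct_mul_smul ρ (inv_cocycle μ) a b w

end FreeModules

/-! ### Gradings -/

section Gradings

variable {k : Type u} [Field k] {A : Type v} [Ring A] [Algebra k A] {𝒜 : ℕ → Submodule k A}

/-- The projection of a graded algebra onto its component of degree `m`. -/
theorem exists_homogeneousProjection (h : DirectSum.IsInternal 𝒜) (m : ℕ) :
    ∃ p : A →ₗ[k] A, (∀ a ∈ 𝒜 m, p a = a) ∧ ∀ j, j ≠ m → ∀ a ∈ 𝒜 j, p a = 0 := by
  let _ := h.chooseDecomposition
  refine ⟨(𝒜 m).subtype ∘ₗ DirectSum.component k ℕ (fun i => 𝒜 i) m ∘ₗ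
    (DirectSum.decomposeLinearEquiv 𝒜).toLinearMap, fun a ha => ?_, fun j hj a ha => ?_⟩
  · exact DirectSum.decompose_of_mem_same 𝒜 ha
  · exact DirectSum.decompose_of_mem_ne 𝒜 ha hj

theorem homogeneous_hom_ext (h : DirectSum.IsInternal 𝒜) {M : Type*} [AddCommGroup M] [Module k M]
    {f g : A →ₗ[k] M} (hfg : ∀ m, ∀ a ∈ 𝒜 m, f a = g a) : f = g := by
  rw [← LinearMap.eqLocus_eq_top, ← top_le_iff, ← h.submodule_iSup_eq_top]
  exact iSup_le fun m a ha => hfg m a ha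

variable {ι ι' : Type*}

/-- The elements of the free module `A^(ι)` all of whose coordinates are homogeneous of
degree `m`. -/
def coordDegree (𝒜 : ℕ → Submodule k A) (ι : Type*) (m : ℕ) : Submodule k (ι →₀ A) where
  carrier := {x | ∀ i, x i ∈ 𝒜 m}
  add_mem' hx hy i := add_mem (hx i) (hy i)
  zero_mem' _ := zero_mem _
  smul_mem' c _ hx i := Submodule.smul_mem _ c (hx i)

theorem mem_coordDegree {m : ℕ} {x : ι →₀ A} : x ∈ coordDegree 𝒜 ι m ↔ ∀ i, x i ∈ 𝒜 m := Iff.rfl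

theorem single_mem_coordDegree {m : ℕ} {a : A} (ha : a ∈ 𝒜 m) (i : ι) :
    Finsupp.single i a ∈ coordDegree 𝒜 ι m := by
  classical
  intro j
  rw [Finsupp.single_apply]
  split_ifs
  · exact ha
  · exact zero_mem _

theorem coordDegree_hom_ext (h : DirectSum.IsInternal 𝒜) {M : Type*} [AddCommGroup M] [Module k M]
    {f g : (ι →₀ A) →ₗ[k] M} (hfg : ∀ m, ∀ x ∈ coordDegree 𝒜 ι m, f x = g x) : f = g :=
  Finsupp.lhom_ext' fun i => homogeneous_hom_ext h fun m _ ha =>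
    hfg m _ (single_mem_coordDegree ha i)

/-- A linear map of degree one commutes with the projections to homogeneous components. -/
theorem map_projection_of_degree_one (h : DirectSum.IsInternal 𝒜) (f : (ι' →₀ A) →ₗ[k] (ι →₀ A))
    (hf : ∀ m, ∀ x ∈ coordDegree 𝒜 ι' m, f x ∈ coordDegree 𝒜 ι (m + 1)) {m : ℕ} {p q : A →ₗ[k] A}
    (hp : ∀ a ∈ 𝒜 m, p a = a) (hp' : ∀ j, j ≠ m → ∀ a ∈ 𝒜 j, p a = 0)
    (hq : ∀ a ∈ 𝒜 (m + 1), q a = a) (hq' : ∀ j, j ≠ m + 1 → ∀ a ∈ 𝒜 j, q a = 0) (x : ι' →₀ A) :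
    Finsupp.mapRange.linearMap q (f x) = f (Finsupp.mapRange.linearMap p x) := by
  suffices Finsupp.mapRange.linearMap q ∘ₗ f = f ∘ₗ Finsupp.mapRange.linearMap p from
    LinearMap.congr_fun this x
  refine coordDegree_hom_ext h fun j x hx => ?_
  have hfx := hf j x hx
  rw [LinearMap.comp_apply, LinearMap.comp_apply]
  by_cases hj : j = m
  · subst hj
    have e1 : Finsupp.mapRange.linearMap q (f x) = f x := by
      ext i; simpa using hq _ (hfx i)
    have e2 : Finsupp.mapRange.linearMap p x = x := by
      ext i; simpa using hp _ (hx i)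
    rw [e1, e2]
  · have e1 : Finsupp.mapRange.linearMap q (f x) = 0 := by
      ext i; simpa using hq' (j + 1) (by lia) _ (hfx i)
    have e2 : Finsupp.mapRange.linearMap p x = 0 := by
      ext i; simpa using hp' j hj _ (hx i)
    rw [e1, e2, map_zero]

/-- The image of a linear map of degree one has no component of degree zero. -/
theorem eq_zero_of_mem_degree_zero (h : DirectSum.IsInternal 𝒜) (f : (ι' →₀ A) →ₗ[k] (ι →₀ A))
    (hf : ∀ m, ∀ x ∈ coordDegree 𝒜 ι' m, f x ∈ coordDegree 𝒜 ι (m + 1)) {x : ι' →₀ A}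
    (hx : f x ∈ coordDegree 𝒜 ι 0) : f x = 0 := by
  obtain ⟨p, hp, hp'⟩ := exists_homogeneousProjection h 0
  have key : Finsupp.mapRange.linearMap p ∘ₗ f = 0 := by
    refine coordDegree_hom_ext h fun j y hy => ?_
    ext i
    simpa using hp' (j + 1) (by lia) _ (hf j y hy i)
  have e : Finsupp.mapRange.linearMap p (f x) = f x := by
    ext i; simpa using hp _ (hx i)
  rw [← e]
  exact LinearMap.congr_fun key x

theorem genMap_mem_coordDegree (h : 𝒜 0 = Submodule.span k {(1 : A)}) (w : ι →₀ k) :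
    genMap k A ι w ∈ coordDegree 𝒜 ι 0 := by
  intro i
  rw [genMap_apply, h, Submodule.mem_span_singleton]
  exact ⟨w i, (Algebra.algebraMap_eq_smul_one _).symm⟩

theorem exists_genMap_eq (h : 𝒜 0 = Submodule.span k {(1 : A)}) (ε' : A →ₐ[k] k) {x : ι →₀ A}
    (hx : x ∈ coordDegree 𝒜 ι 0) : ∃ w, genMap k A ι w = x := by
  refine ⟨Finsupp.mapRange.linearMap ε'.toLinearMap x, ?_⟩
  ext i
  have hi := hx i
  rw [h, Submodule.mem_span_singleton] at hi
  obtain ⟨c, hc⟩ := hi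
  rw [genMap_apply, ← Algebra.algebraMap_eq_smul_one] at *
  simp [← hc]

theorem genMap_injective [Nontrivial A] : Function.Injective (genMap k A ι) :=
  Finsupp.mapRange_injective _ (map_zero _) (algebraMap k A).injective

theorem mem_freeDegree_of_le {ι : Type v} {n j : ℕ} (h : n ≤ j) {x : ι →₀ A} :
    x ∈ freeDegree 𝒜 ι n j ↔ x ∈ coordDegree 𝒜 ι (j - n) := by
  simp only [freeDegree, Set.mem_ofPred_eq, if_pos h, mem_coordDegree]

theorem eq_zero_of_mem_freeDegree {ι : Type v} {n j : ℕ} (h : ¬ n ≤ j) {x : ι →₀ A}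
    (hx : x ∈ freeDegree 𝒜 ι n j) : x = 0 := by
  simp only [freeDegree, Set.mem_ofPred_eq, if_neg h] at hx
  exact Finsupp.ext hx

theorem zero_mem_freeDegree {ι : Type v} {n j : ℕ} : (0 : ι →₀ A) ∈ freeDegree 𝒜 ι n j := by
  intro i
  split_ifs
  · exact zero_mem _
  · rfl

/-- In terms of coordinates, the differentials of a linear resolution raise degrees by one. -/
theorem LinearFreeResolution.d_mem_coordDegree {ε' : A →ₐ[k] k} (P : LinearFreeResolution 𝒜 ε')
    (n m : ℕ) (x : P.ι (n + 1) →₀ A) (hx : x ∈ coordDegree 𝒜 (P.ι (n + 1)) m) :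
    P.d n x ∈ coordDegree 𝒜 (P.ι n) (m + 1) := by
  have := P.d_degree n (n + 1 + m) x ((mem_freeDegree_of_le (by lia)).2 (by simpa using hx))
  rwa [mem_freeDegree_of_le (by lia), show n + 1 + m - n = m + 1 by lia] at this

end Gradings

/-! ### Equivariance of linear resolutions -/

section Equivariance

variable {k : Type u} [Field k] {H : Type w} [Ring H] [HopfAlgebra k H]
variable {A : Type v} [Ring A] [Algebra k A] [Module H A] [IsScalarTower k H A]
variable {𝒜 : ℕ → Submodule k A} {ι ι' : Type*}

theorem freeAct_mem_coordDegree (hdeg : ∀ (i : ℕ) (h : H), ∀ a ∈ 𝒜 i, h • a ∈ 𝒜 i)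
    (ρ : H →ₐ[k] Module.End k (ι →₀ k)) (z : H ⊗[k] H) {m : ℕ} {x : ι →₀ A}
    (hx : x ∈ coordDegree 𝒜 ι m) : freeAct A ρ z x ∈ coordDegree 𝒜 ι m := by
  rw [← Finsupp.sum_single x, Finsupp.sum, map_sum]
  refine Submodule.sum_mem _ fun i _ => ?_
  rw [single_eq_smul_genMap (k := k)]
  induction z with
  | zero => simp
  | add z z' hz hz' => rw [map_add]; exact add_mem hz hz'
  | tmul h g =>
    rw [freeAct_smul_genMap]
    intro j
    rw [Finsupp.smul_apply, genMap_apply, smul_eq_mul, ← Algebra.commutes, ← Algebra.smul_def]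
    exact Submodule.smul_mem _ _ (hdeg m h _ (hx i))

variable [IsModuleAlgebra k H A]

/-- An `A`-linear map from a free module is equivariant as soon as it is so on the generators. -/
theorem map_diagAction_of_genMap (f : (ι' →₀ A) →ₗ[A] (ι →₀ A))
    (ρ : H →ₐ[k] Module.End k (ι →₀ k)) (ρ' : H →ₐ[k] Module.End k (ι' →₀ k))
    (hf : ∀ h w, f (genMap k A ι' (ρ' h w)) =
      diagAction (freeAct A ρ) h (f (genMap k A ι' w))) (h : H) (x : ι' →₀ A) :
    f (diagAction (freeAct A ρ') h x) = diagAction (freeAct A ρ) h (f x) := by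
  have key (z : H ⊗[k] H) (a : A) (w : ι' →₀ k) : f (freeAct A ρ' z (a • genMap k A ι' w)) =
      smulMap k A (ι →₀ A) (tensorAction (Algebra.lsmul k k A) (diagAction (freeAct A ρ)) z
        (a ⊗ₜ f (genMap k A ι' w))) := by
    induction z with
    | zero => simp
    | add z z' hz hz' => simp only [map_add, LinearMap.add_apply, hz, hz']
    | tmul h g =>
      rw [freeAct_smul_genMap, map_smul, hf, tensorAction_tmul, smulMap_tmul]
      rfl
  induction x using Finsupp.induction_linear with
  | zero => simp
  | add x y hx hy => simp only [map_add, hx, hy]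
  | single i a =>
    rw [single_eq_smul_genMap (k := k), diagAction_apply, key, map_smul, diagAction_smul]

/-- If `f : A ⊗ W' → A ⊗ W` is of degree one, injective on `W'`, and has an `H`-stable image, then
the action of `H` on `A ⊗ W` lifts along `f`: the image of `W'` is the lowest degree component of
the image of `f`, so it is `H`-stable. -/
theorem exists_equivariant_action (hA : IsConnectedGraded 𝒜) (ε' : A →ₐ[k] k)
    (hdeg : ∀ (i : ℕ) (h : H), ∀ a ∈ 𝒜 i, h • a ∈ 𝒜 i)
    (f : (ι' →₀ A) →ₗ[A] (ι →₀ A))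
    (hf : ∀ m, ∀ x ∈ coordDegree 𝒜 ι' m, f x ∈ coordDegree 𝒜 ι (m + 1))
    (hinj : ∀ x ∈ coordDegree 𝒜 ι' 0, f x = 0 → x = 0)
    (ρ : H →ₐ[k] Module.End k (ι →₀ k))
    (hstab : ∀ h x, diagAction (freeAct A ρ) h (f x) ∈ LinearMap.range f) :
    ∃ ρ' : H →ₐ[k] Module.End k (ι' →₀ k), ∀ h x,
      f (diagAction (freeAct A ρ') h x) = diagAction (freeAct A ρ) h (f x) := by
  have := hA.nontrivial
  let g : (ι' →₀ k) →ₗ[k] (ι →₀ A) := f.restrictScalars k ∘ₗ genMap k A ι'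
  have hg : Function.Injective g := by
    refine (injective_iff_map_eq_zero g).2 fun w hw => ?_
    have := hinj _ (genMap_mem_coordDegree hA.degree_zero w) hw
    rwa [map_eq_zero_iff _ genMap_injective] at this
  have hmem (w : ι' →₀ k) : g w ∈ coordDegree 𝒜 ι 1 :=
    hf 0 _ (genMap_mem_coordDegree hA.degree_zero w)
  have hstab' (h : H) (y : ι →₀ A) (hy : y ∈ LinearMap.range g) :
      diagAction (freeAct A ρ) h y ∈ LinearMap.range g := by
    obtain ⟨w, rfl⟩ := hy
    obtain ⟨y, hy⟩ := hstab h (genMap k A ι' w)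
    -- The preimage `y` need not be homogeneous; its component of degree zero has the same image.
    obtain ⟨p, hp, hp'⟩ := exists_homogeneousProjection hA.isInternal 0
    obtain ⟨q, hq, hq'⟩ := exists_homogeneousProjection hA.isInternal 1
    have e := map_projection_of_degree_one hA.isInternal (f.restrictScalars k) hf hp hp' hq hq' y
    have hdy : f y ∈ coordDegree 𝒜 ι 1 := by
      rw [hy]
      exact freeAct_mem_coordDegree hdeg ρ _ (hmem w)
    have e' : Finsupp.mapRange.linearMap q (f y) = f y := by
      ext i; simpa using hq _ (hdy i)
    have hpy : Finsupp.mapRange.linearMap p y ∈ coordDegree 𝒜 ι' 0 := by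
      intro i
      rw [Finsupp.mapRange.linearMap_apply, Finsupp.mapRange_apply]
      suffices ∀ a, p a ∈ 𝒜 0 from this _
      intro a
      have : (⊤ : Submodule k A) ≤ (𝒜 0).comap p := by
        rw [← hA.isInternal.submodule_iSup_eq_top]
        refine iSup_le fun j a ha => ?_
        rw [Submodule.mem_comap]
        by_cases hj : j = 0
        · subst hj; rw [hp a ha]; exact ha
        · rw [hp' j hj a ha]; exact zero_mem _
      exact this trivial
    obtain ⟨w', hw'⟩ := exists_genMap_eq hA.degree_zero ε' hpy
    refine ⟨w', ?_⟩
    change f (genMap k A ι' w') = diagAction (freeAct A ρ) h (f (genMap k A ι' w))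
    rw [hw', ← hy, ← e']
    exact e.symm
  let E : (ι' →₀ k) ≃ₗ[k] LinearMap.range g := LinearEquiv.ofInjective g hg
  let ρN : H →ₐ[k] Module.End k (LinearMap.range g) :=
    { toFun h := (diagAction (freeAct A ρ) h).restrict (hstab' h)
      map_one' := by ext; simp
      map_mul' x y := by ext z; simp
      map_zero' := by ext; simp
      map_add' x y := by ext z; simp
      commutes' r := by ext; simp }
  refine ⟨(E.symm.conjAlgEquiv k).toAlgHom.comp ρN, map_diagAction_of_genMap f ρ _ fun h w => ?_⟩
  change g (E.symm (ρN h (E w))) = _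
  have : ∀ z, g (E.symm z) = z := fun z => congrArg Subtype.val (E.apply_symm_apply z)
  rw [this]
  rfl

/-- The map `ε ⊗ ε` from `H ⊗ H` to `k`. -/
def counit₂ (k : Type u) (H : Type w) [Field k] [Ring H] [HopfAlgebra k H] : H ⊗[k] H →ₗ[k] k :=
  Coalgebra.counit (R := k) (A := H) ∘ₗ (TensorProduct.lid k H).toLinearMap ∘ₗ
    LinearMap.rTensor H (Coalgebra.counit (R := k) (A := H))

theorem counit₂_tmul (h g : H) : counit₂ k H (h ⊗ₜ g) =
    Coalgebra.counit (R := k) h * Coalgebra.counit (R := k) g := by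
  simp [counit₂]

theorem counit₂_comul (h : H) : counit₂ k H (Coalgebra.comul (R := k) h) =
    Coalgebra.counit (R := k) h := by
  simp [counit₂]

theorem counit₂_inv (μ : CounitalTwoCocycle k H) : counit₂ k H (↑μ.val⁻¹) = 1 := by
  simp only [counit₂, LinearMap.comp_apply, LinearEquiv.coe_coe]
  rw [inv_counit_left, Bialgebra.counit_one]

variable {ε' : A →ₐ[k] k}

/-- The augmentation is equivariant for the action of `H` on `k` through the counit. -/
theorem augmentation_smul (hA : IsConnectedGraded 𝒜) (hε : IsAugmentation 𝒜 ε')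
    (hdeg : ∀ (i : ℕ) (h : H), ∀ a ∈ 𝒜 i, h • a ∈ 𝒜 i) (h : H) (a : A) :
    ε' (h • a) = Coalgebra.counit (R := k) h * ε' a := by
  suffices ε'.toLinearMap ∘ₗ Algebra.lsmul k k A h =
      (Coalgebra.counit (R := k) h : k) • ε'.toLinearMap from LinearMap.congr_fun this a
  refine homogeneous_hom_ext hA.isInternal fun m a ha => ?_
  change ε' (h • a) = Coalgebra.counit (R := k) h * ε' a
  rcases Nat.eq_zero_or_pos m with rfl | hm
  · rw [hA.degree_zero, Submodule.mem_span_singleton] at ha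
    obtain ⟨c, rfl⟩ := ha
    rw [smul_comm h c, IsModuleAlgebra.smul_one_eq (k := k)]
    simp [mul_comm]
  · rw [hε m hm a ha, hε m hm _ (hdeg m h a ha), mul_zero]

/-- For `z = μ⁻¹` this says that the augmentation is multiplicative for the twisted product. -/
theorem augmentation_mul' (hA : IsConnectedGraded 𝒜) (hε : IsAugmentation 𝒜 ε')
    (hdeg : ∀ (i : ℕ) (h : H), ∀ a ∈ 𝒜 i, h • a ∈ 𝒜 i) (z : H ⊗[k] H) (a b : A) :
    ε' (LinearMap.mul' k A (act₂ k H A z (a ⊗ₜ b))) = counit₂ k H z * (ε' a * ε' b) := by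
  induction z with
  | zero => simp
  | add z z' hz hz' => simp only [map_add, LinearMap.add_apply, add_mul, hz, hz']
  | tmul h g =>
    rw [tensorAction_tmul, LinearMap.mul'_apply, map_mul, Algebra.lsmul_coe, Algebra.lsmul_coe,
      augmentation_smul hA hε hdeg, augmentation_smul hA hε hdeg, counit₂_tmul]
    ring

/-- The action of `H` through the counit. -/
def trivialAction (k : Type u) (H : Type w) [Field k] [Ring H] [HopfAlgebra k H] (W : Type*)
    [AddCommGroup W] [Module k W] : H →ₐ[k] Module.End k W :=
  (Algebra.ofId k (Module.End k W)).comp (Bialgebra.counitAlgHom k H)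

theorem trivialAction_apply {W : Type*} [AddCommGroup W] [Module k W] (h : H) (x : W) :
    trivialAction k H W h x = (Coalgebra.counit (R := k) h : k) • x := by
  simp [trivialAction, Algebra.ofId_apply]

theorem semilinear_map_smul (π : (ι →₀ A) →ₛₗ[(ε' : A →+* k)] k) (c : k) (x : ι →₀ A) :
    π (c • x) = c * π x := by
  rw [← algebraMap_smul A c x, map_smulₛₗ]
  simp

theorem semilinear_freeAct (hA : IsConnectedGraded 𝒜) (hε : IsAugmentation 𝒜 ε')
    (hdeg : ∀ (i : ℕ) (h : H), ∀ a ∈ 𝒜 i, h • a ∈ 𝒜 i)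
    (π : (ι →₀ A) →ₛₗ[(ε' : A →+* k)] k) (z : H ⊗[k] H) (x : ι →₀ A) :
    π (freeAct A (trivialAction k H (ι →₀ k)) z x) = counit₂ k H z * π x := by
  induction x using Finsupp.induction_linear with
  | zero => simp
  | add x y hx hy => simp only [map_add, mul_add, hx, hy]
  | single i a =>
    rw [single_eq_smul_genMap (k := k)]
    induction z with
    | zero => simp
    | add z z' hz hz' => simp only [map_add, LinearMap.add_apply, add_mul, hz, hz']
    | tmul h g =>
      rw [freeAct_smul_genMap, π.map_smulₛₗ, π.map_smulₛₗ, trivialAction_apply,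
        (genMap k A ι).map_smul,
        semilinear_map_smul, counit₂_tmul, RingHom.coe_coe, augmentation_smul hA hε hdeg,
        smul_eq_mul, smul_eq_mul]
      ring

theorem semilinear_diagAction (hA : IsConnectedGraded 𝒜) (hε : IsAugmentation 𝒜 ε')
    (hdeg : ∀ (i : ℕ) (h : H), ∀ a ∈ 𝒜 i, h • a ∈ 𝒜 i)
    (π : (ι →₀ A) →ₛₗ[(ε' : A →+* k)] k) (h : H) (x : ι →₀ A) :
    π (diagAction (freeAct A (trivialAction k H (ι →₀ k))) h x) =
      Coalgebra.counit (R := k) h * π x := by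
  rw [diagAction_apply, semilinear_freeAct hA hε hdeg, counit₂_comul]

/-- Dependent choice along a tower of types. -/
theorem exists_dependent_sequence {S : ℕ → Type*} {Q : ∀ n, S n → S (n + 1) → Prop} (s₀ : S 0)
    (next : ∀ n s, ∃ s', Q n s s') : ∃ s : ∀ n, S n, s 0 = s₀ ∧ ∀ n, Q n (s n) (s (n + 1)) := by
  choose F hF using next
  exact ⟨fun n => Nat.rec s₀ F n, rfl, fun n => hF n _⟩

/-- Every linear free resolution of `k` over `A` carries an action of `H` for which it is
`H`-equivariant. -/
theorem LinearFreeResolution.exists_equivariant (hA : IsConnectedGraded 𝒜)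
    (hε : IsAugmentation 𝒜 ε') (hdeg : ∀ (i : ℕ) (h : H), ∀ a ∈ 𝒜 i, h • a ∈ 𝒜 i)
    (P : LinearFreeResolution 𝒜 ε') :
    ∃ ρ : ∀ n, H →ₐ[k] Module.End k (P.ι n →₀ k), ρ 0 = trivialAction k H (P.ι 0 →₀ k) ∧
      ∀ n h x, P.d n (diagAction (freeAct A (ρ (n + 1))) h x) =
        diagAction (freeAct A (ρ n)) h (P.d n x) := by
  -- A cycle of degree zero is a boundary, and boundaries have no component of degree zero.
  have hinj (n : ℕ) (x) (hx : x ∈ coordDegree 𝒜 (P.ι (n + 1)) 0) (h0 : P.d n x = 0) : x = 0 := by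
    obtain ⟨y, rfl⟩ := (P.exact_succ n x).1 h0
    exact eq_zero_of_mem_degree_zero hA.isInternal ((P.d (n + 1)).restrictScalars k)
      (P.d_mem_coordDegree (n + 1)) hx
  have step (n : ℕ) (ρ : H →ₐ[k] Module.End k (P.ι n →₀ k)) := exists_equivariant_action hA ε' hdeg
    (P.d n) (P.d_mem_coordDegree n) (hinj n) ρ
  let S (n : ℕ) := {ρ : H →ₐ[k] Module.End k (P.ι n →₀ k) //
    ∀ h x, diagAction (freeAct A ρ) h (P.d n x) ∈ LinearMap.range (P.d n)}
  have next (n : ℕ) (ρ : S n) : ∃ ρ' : S (n + 1), ∀ h x,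
      P.d n (diagAction (freeAct A ρ'.1) h x) = diagAction (freeAct A ρ.1) h (P.d n x) := by
    obtain ⟨ρ', hρ'⟩ := step n ρ.1 ρ.2
    refine ⟨⟨ρ', fun h x => (P.exact_succ n _).1 ?_⟩, hρ'⟩
    rw [hρ', (P.exact_succ n).apply_apply_eq_zero, map_zero]
  obtain ⟨s, hs₀, hs⟩ := exists_dependent_sequence
    ⟨trivialAction k H (P.ι 0 →₀ k), fun h x => (P.exact_zero _).1 <| by
      rw [semilinear_diagAction hA hε hdeg, P.exact_zero.apply_apply_eq_zero, mul_zero]⟩ next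
  exact ⟨fun n => (s n).1, congrArg Subtype.val hs₀, hs⟩

end Equivariance

/-! ### The twisted resolution -/

section TwistedResolution

variable {k : Type u} [Field k] {H : Type w} [Ring H] [HopfAlgebra k H]
variable (μ : CounitalTwoCocycle k H)
variable {A : Type v} [Ring A] [Algebra k A] [Module H A] [IsScalarTower k H A]
variable [IsModuleAlgebra k H A]
variable {𝒜 : ℕ → Submodule k A} {ι ι' : Type*}

theorem mem_twistGrading {m : ℕ} {a : DrinfeldTwist μ A} :
    a ∈ twistGrading μ 𝒜 m ↔ (toTwist μ).symm a ∈ 𝒜 m :=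
  Submodule.mem_map_equiv _

theorem toTwist_symm_mul (a b : DrinfeldTwist μ A) :
    (toTwist μ).symm (a * b) = twistMul μ ((toTwist μ).symm a) ((toTwist μ).symm b) := rfl

/-- The identification `x ↦ μ⁻¹ ▷ x` of the free `A_μ`-module `A_μ^(ι) = A_μ ⊗ k^(ι)` with
`A^(ι) = A ⊗ k^(ι)`. -/
def twistFree (ρ : H →ₐ[k] Module.End k (ι →₀ k)) : (ι →₀ DrinfeldTwist μ A) ≃ₗ[k] (ι →₀ A) :=
  (Finsupp.mapRange.linearEquiv (toTwist μ).symm).trans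
    { freeAct A ρ (↑μ.val⁻¹) with
      invFun := freeAct A ρ (↑μ.val)
      left_inv x := by
        change freeAct A ρ (↑μ.val) (freeAct A ρ (↑μ.val⁻¹) x) = x
        rw [← Module.End.mul_apply, ← map_mul, Units.mul_inv, map_one, Module.End.one_apply]
      right_inv x := by
        change freeAct A ρ (↑μ.val⁻¹) (freeAct A ρ (↑μ.val) x) = x
        rw [← Module.End.mul_apply, ← map_mul, Units.inv_mul, map_one, Module.End.one_apply] }

theorem twistFree_apply (ρ : H →ₐ[k] Module.End k (ι →₀ k)) (x : ι →₀ DrinfeldTwist μ A) :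
    twistFree μ ρ x = freeAct A ρ (↑μ.val⁻¹)
      (Finsupp.mapRange.linearEquiv (toTwist μ).symm x) := rfl

theorem twistFree_symm_apply (ρ : H →ₐ[k] Module.End k (ι →₀ k)) (x : ι →₀ A) :
    (twistFree μ ρ).symm x = Finsupp.mapRange.linearEquiv (toTwist μ) (freeAct A ρ (↑μ.val) x) :=
  rfl

/-- On `A^(ι)`, the multiplication of the free `A_μ`-module becomes `a, p ↦ m(μ⁻¹ ▷ (a ⊗ p))`. -/
theorem twistFree_smul (ρ : H →ₐ[k] Module.End k (ι →₀ k)) (a : DrinfeldTwist μ A)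
    (x : ι →₀ DrinfeldTwist μ A) :
    twistFree μ ρ (a • x) =
    smulMap k A (ι →₀ A) (tensorAction (Algebra.lsmul k k A) (diagAction (freeAct A ρ))
      (↑μ.val⁻¹ : H ⊗[k] H) ((toTwist μ).symm a ⊗ₜ twistFree μ ρ x)) := by
  induction x using Finsupp.induction_linear with
  | zero => simp
  | add x y hx hy => simp only [smul_add, TensorProduct.tmul_add, map_add, hx, hy]
  | single i b =>
    rw [Finsupp.smul_single, smul_eq_mul, twistFree_apply, twistFree_apply,
      Finsupp.mapRange.linearEquiv_apply, Finsupp.mapRange_single,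
      Finsupp.mapRange.linearEquiv_apply, Finsupp.mapRange_single,
      toTwist_symm_mul, single_eq_smul_genMap (k := k), freeAct_twistMul_smul,
      ← single_eq_smul_genMap]

theorem twistFree_mem_coordDegree (hdeg : ∀ (i : ℕ) (h : H), ∀ a ∈ 𝒜 i, h • a ∈ 𝒜 i)
    (ρ : H →ₐ[k] Module.End k (ι →₀ k)) {m : ℕ} {x : ι →₀ DrinfeldTwist μ A}
    (hx : x ∈ coordDegree (twistGrading μ 𝒜) ι m) : twistFree μ ρ x ∈ coordDegree 𝒜 ι m := by
  rw [twistFree_apply]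
  exact freeAct_mem_coordDegree hdeg ρ _ fun i => (mem_twistGrading μ).1 (hx i)

theorem twistFree_symm_mem_coordDegree (hdeg : ∀ (i : ℕ) (h : H), ∀ a ∈ 𝒜 i, h • a ∈ 𝒜 i)
    (ρ : H →ₐ[k] Module.End k (ι →₀ k)) {m : ℕ} {x : ι →₀ A}
    (hx : x ∈ coordDegree 𝒜 ι m) :
    (twistFree μ ρ).symm x ∈ coordDegree (twistGrading μ 𝒜) ι m := by
  intro i
  rw [twistFree_symm_apply]
  exact (mem_twistGrading μ).2 (freeAct_mem_coordDegree hdeg ρ (↑μ.val) hx i)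

/-- An equivariant `A`-linear map of free modules, regarded as an `A_μ`-linear map. -/
def twistHom (ρ' : H →ₐ[k] Module.End k (ι' →₀ k)) (ρ : H →ₐ[k] Module.End k (ι →₀ k))
    (f : (ι' →₀ A) →ₗ[A] (ι →₀ A))
    (hf : ∀ h x, f (diagAction (freeAct A ρ') h x) = diagAction (freeAct A ρ) h (f x)) :
    (ι' →₀ DrinfeldTwist μ A) →ₗ[DrinfeldTwist μ A] (ι →₀ DrinfeldTwist μ A) where
  toFun x := (twistFree μ ρ).symm (f (twistFree μ ρ' x))
  map_add' x y := by simp only [map_add]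
  map_smul' a x := by
    have key (z : H ⊗[k] H) (b : A) (p : ι' →₀ A) :
        f (smulMap k A (ι' →₀ A) (tensorAction (Algebra.lsmul k k A) (diagAction (freeAct A ρ'))
          z (b ⊗ₜ p))) =
        smulMap k A (ι →₀ A) (tensorAction (Algebra.lsmul k k A) (diagAction (freeAct A ρ))
          z (b ⊗ₜ f p)) := by
      induction z with
      | zero => simp
      | add z z' hz hz' => simp only [map_add, LinearMap.add_apply, hz, hz']
      | tmul h g => simp only [tensorAction_tmul, smulMap_tmul, map_smul, hf]
    rw [LinearEquiv.symm_apply_eq, RingHom.id_apply, twistFree_smul, twistFree_smul, key,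
      LinearEquiv.apply_symm_apply]

theorem twistHom_apply (ρ' : H →ₐ[k] Module.End k (ι' →₀ k))
    (ρ : H →ₐ[k] Module.End k (ι →₀ k)) (f : (ι' →₀ A) →ₗ[A] (ι →₀ A))
    (hf : ∀ h x, f (diagAction (freeAct A ρ') h x) = diagAction (freeAct A ρ) h (f x))
    (x : ι' →₀ DrinfeldTwist μ A) :
    twistHom μ ρ' ρ f hf x = (twistFree μ ρ).symm (f (twistFree μ ρ' x)) := rfl

variable {ε' : A →ₐ[k] k}

/-- The augmentation of `A`, regarded as a character of `A_μ`. -/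
def twistAugmentation (hA : IsConnectedGraded 𝒜) (hε : IsAugmentation 𝒜 ε')
    (hdeg : ∀ (i : ℕ) (h : H), ∀ a ∈ 𝒜 i, h • a ∈ 𝒜 i) : DrinfeldTwist μ A →ₐ[k] k :=
  AlgHom.ofLinearMap (ε'.toLinearMap ∘ₗ (toTwist μ).symm.toLinearMap) (map_one ε') fun a b => by
    have := augmentation_mul' (H := H) hA hε hdeg (↑μ.val⁻¹) ((toTwist μ).symm a)
      ((toTwist μ).symm b)
    rwa [counit₂_inv, one_mul] at this

theorem IsConnectedGraded.twist (hA : IsConnectedGraded 𝒜)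
    (hdeg : ∀ (i : ℕ) (h : H), ∀ a ∈ 𝒜 i, h • a ∈ 𝒜 i) :
    IsConnectedGraded (twistGrading μ 𝒜) where
  isInternal := by
    have h := (DirectSum.isInternal_submodule_iff_iSupIndep_and_iSup_eq_top 𝒜).1 hA.isInternal
    refine (DirectSum.isInternal_submodule_iff_iSupIndep_and_iSup_eq_top _).2
      ⟨h.1.map_orderIso (Submodule.orderIsoMapComap (toTwist μ)), ?_⟩
    change ⨆ i, (𝒜 i).map (toTwist μ).toLinearMap = ⊤
    rw [← Submodule.map_iSup, h.2, Submodule.map_top, LinearEquiv.range]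
  mul_mem i j a ha b hb := by
    rw [mem_twistGrading] at *
    rw [toTwist_symm_mul, twistMul]
    generalize (↑μ.val⁻¹ : H ⊗[k] H) = z
    induction z with
    | zero => simp
    | add z z' hz hz' => rw [map_add, LinearMap.add_apply, map_add]; exact add_mem hz hz'
    | tmul h g => exact hA.mul_mem i j _ (hdeg i h _ ha) _ (hdeg j g _ hb)
  nontrivial := hA.nontrivial
  degree_zero := by
    rw [twistGrading, hA.degree_zero, Submodule.map_span, Set.image_singleton]
    rfl
  finite i := by
    have := hA.finite i
    exact inferInstanceAs (FiniteDimensional k ((𝒜 i).map (toTwist μ).toLinearMap))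

/-- Twisting an equivariant linear resolution gives a linear resolution. -/
def LinearFreeResolution.twist (hA : IsConnectedGraded 𝒜) (hε : IsAugmentation 𝒜 ε')
    (hdeg : ∀ (i : ℕ) (h : H), ∀ a ∈ 𝒜 i, h • a ∈ 𝒜 i) (P : LinearFreeResolution 𝒜 ε')
    (ρ : ∀ n, H →ₐ[k] Module.End k (P.ι n →₀ k)) (hρ₀ : ρ 0 = trivialAction k H (P.ι 0 →₀ k))
    (hρ : ∀ n h x, P.d n (diagAction (freeAct A (ρ (n + 1))) h x) =
      diagAction (freeAct A (ρ n)) h (P.d n x)) :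
    LinearFreeResolution (twistGrading μ 𝒜) (twistAugmentation μ hA hε hdeg) where
  ι := P.ι
  d n := twistHom μ (ρ (n + 1)) (ρ n) (P.d n) (hρ n)
  π :=
    { toFun x := P.π (twistFree μ (ρ 0) x)
      map_add' x y := by simp only [map_add]
      map_smul' a x := by
        have key (z : H ⊗[k] H) (b : A) (p : P.ι 0 →₀ A) :
            P.π (smulMap k A (P.ι 0 →₀ A) (tensorAction (Algebra.lsmul k k A)
              (diagAction (freeAct A (ρ 0))) z (b ⊗ₜ p))) = counit₂ k H z * (ε' b * P.π p) := by
          rw [hρ₀]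
          induction z with
          | zero => simp
          | add z z' hz hz' => simp only [map_add, LinearMap.add_apply, add_mul, hz, hz']
          | tmul h g =>
            rw [tensorAction_tmul, smulMap_tmul, P.π.map_smulₛₗ,
              semilinear_diagAction hA hε hdeg, counit₂_tmul, RingHom.coe_coe,
              Algebra.lsmul_coe, augmentation_smul hA hε hdeg, smul_eq_mul]
            ring
        rw [twistFree_smul, key, counit₂_inv, one_mul]
        rfl }
  d_degree n j x hx := by
    by_cases hj : n + 1 ≤ j
    · rw [mem_freeDegree_of_le hj] at hx
      rw [mem_freeDegree_of_le (by lia), twistHom_apply, show j - n = j - (n + 1) + 1 by lia]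
      exact twistFree_symm_mem_coordDegree μ hdeg _
        (P.d_mem_coordDegree n _ _ (twistFree_mem_coordDegree μ hdeg _ hx))
    · rw [eq_zero_of_mem_freeDegree hj hx, map_zero]
      exact zero_mem_freeDegree
  π_degree j hj x hx := by
    rw [mem_freeDegree_of_le j.zero_le] at hx
    exact P.π_degree j hj _ ((mem_freeDegree_of_le j.zero_le).2
      (twistFree_mem_coordDegree μ hdeg _ hx))
  exact_succ n x := by
    rw [twistHom_apply, (twistFree μ (ρ n)).symm.map_eq_zero_iff, P.exact_succ n]
    constructor
    · rintro ⟨y, hy⟩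
      refine ⟨(twistFree μ (ρ (n + 1 + 1))).symm y, ?_⟩
      rw [twistHom_apply, LinearEquiv.apply_symm_apply, hy, LinearEquiv.symm_apply_apply]
    · rintro ⟨y, rfl⟩
      exact ⟨_, by rw [twistHom_apply, LinearEquiv.apply_symm_apply]⟩
  exact_zero x := by
    change P.π (twistFree μ (ρ 0) x) = 0 ↔ _
    rw [P.exact_zero]
    constructor
    · rintro ⟨y, hy⟩
      refine ⟨(twistFree μ (ρ 1)).symm y, ?_⟩
      rw [twistHom_apply, LinearEquiv.apply_symm_apply, hy, LinearEquiv.symm_apply_apply]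
    · rintro ⟨y, rfl⟩
      exact ⟨_, by rw [twistHom_apply, LinearEquiv.apply_symm_apply]⟩
  surjective := P.surjective.comp (twistFree μ (ρ 0)).surjective

/-- The Drinfeld twist of a Koszul algebra is Koszul. -/
theorem IsKoszul.twist (hA : IsKoszul 𝒜)
    (hdeg : ∀ (i : ℕ) (h : H), ∀ a ∈ 𝒜 i, h • a ∈ 𝒜 i) : IsKoszul (twistGrading μ 𝒜) := by
  obtain ⟨hA, ε', hε, ⟨P⟩⟩ := hA
  obtain ⟨ρ, hρ₀, hρ⟩ := P.exists_equivariant hA hε hdeg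
  refine ⟨hA.twist μ hdeg, twistAugmentation μ hA hε hdeg, fun i hi a ha => ?_,
    ⟨P.twist μ hA hε hdeg ρ hρ₀ hρ⟩⟩
  exact hε i hi _ ((mem_twistGrading μ).1 ha)

end TwistedResolution

/-! ### Twisting products of `H`-stable subspaces -/

section StableSubspaces

variable {k : Type u} [Field k] {H : Type w} [Ring H]
variable {T : Type v} [Ring T] [Algebra k T] [Module H T]

/-- A subspace stable under the action of `H`. -/
def IsStable (H : Type w) [Ring H] [Module H T] (X : Submodule k T) : Prop :=
  ∀ h : H, ∀ x ∈ X, h • x ∈ X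

theorem isStable_top : IsStable H (⊤ : Submodule k T) := fun _ _ _ => trivial

variable [HopfAlgebra k H] (μ : CounitalTwoCocycle k H) [IsScalarTower k H T]

theorem mul'_act_mem {X Y : Submodule k T} (hX : IsStable H X) (hY : IsStable H Y) (z : H ⊗[k] H)
    {x y : T} (hx : x ∈ X) (hy : y ∈ Y) :
    LinearMap.mul' k T (act₂ k H T z (x ⊗ₜ y)) ∈ X * Y := by
  induction z with
  | zero => simp
  | add z z' hz hz' => rw [map_add, LinearMap.add_apply, map_add]; exact add_mem hz hz'
  | tmul h g => exact Submodule.mul_mem_mul (hX h x hx) (hY g y hy)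

variable [IsModuleAlgebra k H T]

theorem IsStable.mul {X Y : Submodule k T} (hX : IsStable H X) (hY : IsStable H Y) :
    IsStable H (X * Y) := by
  intro h z hz
  induction hz using Submodule.mul_induction_on' with
  | mem_mul_mem x hx y hy =>
    rw [IsModuleAlgebra.smul_mul_eq (k := k)]
    exact mul'_act_mem hX hY _ hx hy
  | add x _ y _ hx hy => rw [smul_add]; exact add_mem hx hy

theorem isStable_one : IsStable H (1 : Submodule k T) := by
  intro h x hx
  rw [Submodule.mem_one] at hx ⊢
  obtain ⟨c, rfl⟩ := hx
  refine ⟨c * Coalgebra.counit (R := k) h, ?_⟩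
  rw [Algebra.algebraMap_eq_smul_one, Algebra.algebraMap_eq_smul_one, smul_comm h c,
    IsModuleAlgebra.smul_one_eq (k := k) h, mul_smul]

theorem IsStable.pow {X : Submodule k T} (hX : IsStable H X) (n : ℕ) : IsStable H (X ^ n) := by
  induction n with
  | zero => exact isStable_one
  | succ n ih => rw [pow_succ]; exact ih.mul hX

/-- On `H`-stable subspaces the products of `T` and `T_μ` agree, because `μ` is invertible. -/
theorem map_toTwist_mul {X Y : Submodule k T} (hX : IsStable H X) (hY : IsStable H Y) :
    (X * Y).map (toTwist μ).toLinearMap =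
      X.map (toTwist μ).toLinearMap * Y.map (toTwist μ).toLinearMap := by
  apply le_antisymm
  · rw [Submodule.map_le_iff_le_comap, Submodule.mul_le]
    intro x hx y hy
    -- For `z = μ` the two actions cancel and leave the product `x * y` of `T`.
    have key (z : H ⊗[k] H) :
        toTwist μ (LinearMap.mul' k T (act₂ k H T (↑μ.val⁻¹) (act₂ k H T z (x ⊗ₜ y)))) ∈
          X.map (toTwist μ).toLinearMap * Y.map (toTwist μ).toLinearMap := by
      induction z with
      | zero => simp
      | add z z' hz hz' => simp only [map_add, LinearMap.add_apply]; exact add_mem hz hz'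
      | tmul h g =>
        rw [tensorAction_tmul]
        exact Submodule.mul_mem_mul (Submodule.mem_map_of_mem (hX h x hx))
          (Submodule.mem_map_of_mem (hY g y hy))
    have := key (↑μ.val)
    rwa [← Module.End.mul_apply, ← map_mul, Units.inv_mul, map_one, Module.End.one_apply] at this
  · rw [Submodule.mul_le]
    rintro _ ⟨x, hx, rfl⟩ _ ⟨y, hy, rfl⟩
    exact Submodule.mem_map_of_mem (mul'_act_mem hX hY (↑μ.val⁻¹) hx hy)

theorem map_toTwist_one :
    (1 : Submodule k T).map (toTwist μ).toLinearMap = (1 : Submodule k (DrinfeldTwist μ T)) := by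
  rw [Submodule.one_eq_span, Submodule.one_eq_span, Submodule.map_span, Set.image_singleton]
  rfl

theorem map_toTwist_pow {X : Submodule k T} (hX : IsStable H X) (n : ℕ) :
    (X ^ n).map (toTwist μ).toLinearMap = X.map (toTwist μ).toLinearMap ^ n := by
  induction n with
  | zero => rw [pow_zero, pow_zero, map_toTwist_one]
  | succ n ih => rw [pow_succ, pow_succ, map_toTwist_mul μ (hX.pow n) hX, ih]

/-- An `H`-equivariant algebra map, regarded as an algebra map of the twists. -/
def twistAlgHom {A : Type*} [Ring A] [Algebra k A] [Module H A] [IsScalarTower k H A]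
    [IsModuleAlgebra k H A] (p : T →ₐ[k] A) (hp : ∀ (h : H) t, p (h • t) = h • p t) :
    DrinfeldTwist μ T →ₐ[k] DrinfeldTwist μ A :=
  AlgHom.ofLinearMap
    ((toTwist μ).toLinearMap ∘ₗ p.toLinearMap ∘ₗ (toTwist μ).symm.toLinearMap) (map_one p)
    fun a b => by
      have key (z : H ⊗[k] H) (s t : T) : p (LinearMap.mul' k T (act₂ k H T z (s ⊗ₜ t))) =
          LinearMap.mul' k A (act₂ k H A z (p s ⊗ₜ p t)) := by
        induction z with
        | zero => simp
        | add z z' hz hz' => simp only [map_add, LinearMap.add_apply, hz, hz']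
        | tmul h g =>
          simp only [tensorAction_tmul, LinearMap.mul'_apply, map_mul, Algebra.lsmul_coe, hp]
      exact key _ _ _

end StableSubspaces

/-! ### The tensor algebra as a module algebra -/

section TensorAlgebraAction

variable {k : Type u} [Field k] {H : Type w} [Ring H] [HopfAlgebra k H]
variable {V : Type v} [AddCommGroup V] [Module k V] (ρ : H →ₐ[k] Module.End k V)

/-- The algebra map from `T(V)` to the convolution algebra `Hom(H, T(V))` whose value at `t` is the
map `h ↦ h ▷ t`, for the action of `H` on `T(V)` by which `T(V)` becomes a module algebra. -/
def tensorAlgebraConv : TensorAlgebra k V →ₐ[k] WithConv (H →ₗ[k] TensorAlgebra k V) :=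
  TensorAlgebra.lift k
    { toFun v := WithConv.toConv (TensorAlgebra.ι k ∘ₗ LinearMap.applyₗ v ∘ₗ ρ.toLinearMap)
      map_add' v w := by ext; simp
      map_smul' c v := by ext; simp }

theorem tensorAlgebraConv_ι (v : V) (h : H) :
    (tensorAlgebraConv ρ (TensorAlgebra.ι k v)).ofConv h = TensorAlgebra.ι k (ρ h v) := by
  rw [tensorAlgebraConv, TensorAlgebra.lift_ι_apply]
  rfl

theorem tensorAlgebraConv_mul (s t : TensorAlgebra k V) (h : H) :
    (tensorAlgebraConv ρ (s * t)).ofConv h = LinearMap.mul' k (TensorAlgebra k V)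
      (TensorProduct.map (tensorAlgebraConv ρ s).ofConv (tensorAlgebraConv ρ t).ofConv
        (Coalgebra.comul (R := k) h)) := by
  rw [map_mul]
  rfl

theorem tensorAlgebraConv_algebraMap (c : k) (h : H) :
    (tensorAlgebraConv ρ (algebraMap k _ c)).ofConv h =
      (Coalgebra.counit (R := k) h : k) • algebraMap k (TensorAlgebra k V) c := by
  rw [AlgHom.commutes, Algebra.smul_def, ← Algebra.commutes, ← Algebra.smul_def]
  rfl

theorem tensorAlgebraConv_one_apply (t : TensorAlgebra k V) :
    (tensorAlgebraConv ρ t).ofConv 1 = t := by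
  induction t using TensorAlgebra.induction with
  | algebraMap c => rw [tensorAlgebraConv_algebraMap]; simp
  | ι v => rw [tensorAlgebraConv_ι]; simp
  | mul s t hs ht =>
    rw [tensorAlgebraConv_mul, Bialgebra.comul_one, Algebra.TensorProduct.one_def,
      TensorProduct.map_tmul, hs, ht, LinearMap.mul'_apply]
  | add s t hs ht => simpa using congrArg₂ (· + ·) hs ht

/-- Both sides are compatible with products in `t`, as `Δ` is multiplicative. -/
theorem tensorAlgebraConv_mul_apply (t : TensorAlgebra k V) (g h : H) :
    (tensorAlgebraConv ρ t).ofConv (g * h) =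
      (tensorAlgebraConv ρ ((tensorAlgebraConv ρ t).ofConv h)).ofConv g := by
  induction t using TensorAlgebra.induction generalizing g h with
  | algebraMap c =>
    simp only [tensorAlgebraConv_algebraMap, map_smul, Bialgebra.counit_mul, WithConv.ofConv_smul,
      LinearMap.smul_apply, mul_smul]
    rw [smul_comm]
  | ι v => simp only [tensorAlgebraConv_ι, map_mul, Module.End.mul_apply]
  | mul s t hs ht =>
    have key (z y : H ⊗[k] H) (hz : ∀ a b, LinearMap.mul' k (TensorAlgebra k V)
          (TensorProduct.map (tensorAlgebraConv ρ a).ofConv (tensorAlgebraConv ρ b).ofConv z) =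
            (tensorAlgebraConv ρ (a * b)).ofConv g) :
        LinearMap.mul' k (TensorAlgebra k V)
          (TensorProduct.map (tensorAlgebraConv ρ s).ofConv (tensorAlgebraConv ρ t).ofConv
            (z * y)) =
        (tensorAlgebraConv ρ (LinearMap.mul' k (TensorAlgebra k V)
          (TensorProduct.map (tensorAlgebraConv ρ s).ofConv (tensorAlgebraConv ρ t).ofConv
            y))).ofConv g := by
      induction y with
      | zero => simp
      | add y y' hy hy' =>
        simp only [mul_add, map_add, WithConv.ofConv_add, LinearMap.add_apply, hy, hy']
      | tmul c d =>
        rw [TensorProduct.map_tmul, LinearMap.mul'_apply, ← hz]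
        clear hz
        induction z with
        | zero => simp
        | add z z' hz hz' => simp only [add_mul, map_add, hz, hz']
        | tmul a b =>
          rw [Algebra.TensorProduct.tmul_mul_tmul, TensorProduct.map_tmul, TensorProduct.map_tmul,
            hs, ht]
    rw [tensorAlgebraConv_mul, tensorAlgebraConv_mul, Bialgebra.comul_mul]
    exact key _ _ fun a b => (tensorAlgebraConv_mul ρ a b g).symm
  | add s t hs ht =>
    simp only [map_add, WithConv.ofConv_add, LinearMap.add_apply, hs, ht]

/-- The action of `H` on `T(V)` extending its action on `V`. -/
@[reducible]
def tensorAlgebraModule : Module H (TensorAlgebra k V) where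
  smul h t := (tensorAlgebraConv ρ t).ofConv h
  one_smul := tensorAlgebraConv_one_apply ρ
  mul_smul g h t := tensorAlgebraConv_mul_apply ρ t g h
  smul_zero h := by
    change (tensorAlgebraConv ρ 0).ofConv h = 0
    rw [map_zero]; rfl
  smul_add h s t := by
    change (tensorAlgebraConv ρ (s + t)).ofConv h = _
    rw [map_add]; rfl
  add_smul g h t := map_add (tensorAlgebraConv ρ t).ofConv g h
  zero_smul t := map_zero (tensorAlgebraConv ρ t).ofConv

theorem tensorAlgebra_isScalarTower :
    letI := tensorAlgebraModule ρ
    IsScalarTower k H (TensorAlgebra k V) :=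
  let _ := tensorAlgebraModule ρ
  ⟨fun c h t => map_smul (tensorAlgebraConv ρ t).ofConv c h⟩

theorem tensorAlgebra_isModuleAlgebra :
    letI := tensorAlgebraModule ρ
    letI := tensorAlgebra_isScalarTower ρ
    IsModuleAlgebra k H (TensorAlgebra k V) := by
  let _ := tensorAlgebraModule ρ
  have := tensorAlgebra_isScalarTower ρ
  refine ⟨fun h s t => ?_, fun h => ?_⟩
  · change (tensorAlgebraConv ρ (s * t)).ofConv h = _
    rw [tensorAlgebraConv_mul]
    congr 1
    generalize Coalgebra.comul (R := k) h = z
    induction z with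
    | zero => simp
    | add z z' hz hz' => simp only [map_add, LinearMap.add_apply, hz, hz']
    | tmul a b => rfl
  · have := tensorAlgebraConv_algebraMap ρ 1 h
    rwa [map_one] at this

end TensorAlgebraAction

/-! ### Quadratic presentations -/

section Quadratic

variable {k : Type u} [Field k]

/-- The two-sided ideal generated by a subspace `X` is `T X T`. -/
theorem mem_twoSidedIdeal_span_iff {T : Type*} [Ring T] [Algebra k T] (X : Submodule k T) {t : T} :
    t ∈ TwoSidedIdeal.span (X : Set T) ↔ t ∈ ⊤ * X * ⊤ := by
  constructor
  · intro ht
    let I : TwoSidedIdeal T := TwoSidedIdeal.mk' ((⊤ * X * ⊤ : Submodule k T) : Set T)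
      (zero_mem _) add_mem neg_mem
      (fun {x y} hy => by
        have : x * y ∈ ⊤ * (⊤ * X * ⊤) := Submodule.mul_mem_mul trivial hy
        rw [← mul_assoc, ← mul_assoc] at this
        exact (mul_le_mul' (mul_le_mul' le_top le_rfl) le_rfl :
          ⊤ * ⊤ * X * ⊤ ≤ ⊤ * X * ⊤) this)
      (fun {x y} hx => by
        have : x * y ∈ ⊤ * X * ⊤ * ⊤ := Submodule.mul_mem_mul hx trivial
        rw [mul_assoc (⊤ * X)] at this
        exact (mul_le_mul' le_rfl le_top : ⊤ * X * (⊤ * ⊤) ≤ ⊤ * X * ⊤) this)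
    have hI : TwoSidedIdeal.span (X : Set T) ≤ I := TwoSidedIdeal.span_le.2 fun x hx => by
      rw [SetLike.mem_coe, TwoSidedIdeal.mem_mk', SetLike.mem_coe]
      have := Submodule.mul_mem_mul (Submodule.mul_mem_mul (show (1 : T) ∈ (⊤ : Submodule k T) from
        trivial) hx) (show (1 : T) ∈ (⊤ : Submodule k T) from trivial)
      rwa [one_mul, mul_one] at this
    have := hI ht
    rwa [TwoSidedIdeal.mem_mk', SetLike.mem_coe] at this
  · intro ht
    induction ht using Submodule.mul_induction_on' with
    | mem_mul_mem y hy b _ =>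
      refine TwoSidedIdeal.mul_mem_right _ _ _ ?_
      induction hy using Submodule.mul_induction_on' with
      | mem_mul_mem a _ x hx =>
        exact TwoSidedIdeal.mul_mem_left _ _ _ (TwoSidedIdeal.subset_span hx)
      | add x _ y _ hx hy => exact add_mem hx hy
    | add x _ y _ hx hy => exact add_mem hx hy

/-- A degree-preserving linear map that is injective in every degree is injective. -/
theorem injective_of_degreewise {T : Type*} [Ring T] [Algebra k T] {𝒯 : ℕ → Submodule k T}
    (h : DirectSum.IsInternal 𝒯) (g : T →ₗ[k] T) (hg : ∀ m, ∀ t ∈ 𝒯 m, g t ∈ 𝒯 m)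
    (hinj : ∀ m, ∀ t ∈ 𝒯 m, g t = 0 → t = 0) : Function.Injective g := by
  let _ := h.chooseDecomposition
  refine (injective_iff_map_eq_zero g).2 fun t ht => ?_
  let p (m : ℕ) : T →ₗ[k] T := (𝒯 m).subtype ∘ₗ DirectSum.component k ℕ (fun i => 𝒯 i) m ∘ₗ
    (DirectSum.decomposeLinearEquiv 𝒯).toLinearMap
  have hp (m : ℕ) (t : T) : p m t = DirectSum.decompose 𝒯 t m := rfl
  have key (m : ℕ) : p m ∘ₗ g = g ∘ₗ p m := homogeneous_hom_ext h fun j a ha => by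
    change p m (g a) = g (p m a)
    rw [hp, hp]
    by_cases hj : j = m
    · subst hj
      rw [DirectSum.decompose_of_mem_same 𝒯 (hg j a ha), DirectSum.decompose_of_mem_same 𝒯 ha]
    · rw [DirectSum.decompose_of_mem_ne 𝒯 (hg j a ha) hj, DirectSum.decompose_of_mem_ne 𝒯 ha hj,
        map_zero]
  refine (DirectSum.decompose 𝒯).injective (DFinsupp.ext fun m => Subtype.ext ?_)
  rw [DirectSum.decompose_zero]
  refine hinj m _ (SetLike.coe_mem _) ?_
  rw [← hp]
  exact (LinearMap.congr_fun (key m) t).symm.trans (by rw [LinearMap.comp_apply, ht, map_zero])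

section TensorAlgebra

variable {V : Type v} [AddCommGroup V] [Module k V]

theorem tensorAlgebra_isInternal : DirectSum.IsInternal
    fun n : ℕ => LinearMap.range (TensorAlgebra.ι k : V →ₗ[k] TensorAlgebra k V) ^ n :=
  DirectSum.Decomposition.isInternal _

theorem map_tensorSquare_le (R : Submodule k (V ⊗[k] V)) :
    R.map (tensorSquare k V) ≤
      LinearMap.range (TensorAlgebra.ι k : V →ₗ[k] TensorAlgebra k V) ^ 2 := by
  rintro _ ⟨r, -, rfl⟩
  rw [pow_two]
  induction r with
  | zero => simp
  | add r s hr hs => rw [map_add]; exact add_mem hr hs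
  | tmul v w =>
    exact Submodule.mul_mem_mul (LinearMap.mem_range_self _ v) (LinearMap.mem_range_self _ w)

/-- The relations are the degree two component of the ideal they generate. -/
theorem mem_of_mem_degree_two (X : Submodule k (TensorAlgebra k V))
    (hX : X ≤ LinearMap.range (TensorAlgebra.ι k : V →ₗ[k] TensorAlgebra k V) ^ 2)
    {t : TensorAlgebra k V} (ht : t ∈ ⊤ * X * ⊤)
    (ht' : t ∈ LinearMap.range (TensorAlgebra.ι k : V →ₗ[k] TensorAlgebra k V) ^ 2) : t ∈ X := by
  set E := LinearMap.range (TensorAlgebra.ι k : V →ₗ[k] TensorAlgebra k V) with hE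
  obtain ⟨p, hp, hp'⟩ := exists_homogeneousProjection (tensorAlgebra_isInternal (k := k) (V := V)) 2
  have htop : (⊤ : Submodule k (TensorAlgebra k V)) = ⨆ n : ℕ, E ^ n :=
    (tensorAlgebra_isInternal (k := k) (V := V)).submodule_iSup_eq_top.symm
  suffices ⊤ * X * ⊤ ≤ X.comap p by
    have := this ht
    rwa [Submodule.mem_comap, hp t ht'] at this
  rw [htop, Submodule.iSup_mul, Submodule.iSup_mul]
  refine iSup_le fun i => ?_
  rw [Submodule.mul_iSup]
  refine iSup_le fun j => ?_
  by_cases hij : i + 2 + j = 2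
  · obtain ⟨rfl, rfl⟩ : i = 0 ∧ j = 0 := by lia
    rw [pow_zero, one_mul, mul_one]
    intro x hx
    rw [Submodule.mem_comap, hp x (hX hx)]
    exact hx
  · intro x hx
    have : x ∈ E ^ (i + 2 + j) := by
      rw [pow_add, pow_add]
      exact mul_le_mul' (mul_le_mul' le_rfl hX) le_rfl hx
    rw [Submodule.mem_comap, hp' _ hij x this]
    exact zero_mem _

end TensorAlgebra

variable {H : Type w} [Ring H] [HopfAlgebra k H] {V : Type v} [AddCommGroup V] [Module k V]
variable [Module H (TensorAlgebra k V)] {ρ : H →ₐ[k] Module.End k V}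

theorem isStable_range_ι (hι : ∀ (h : H) v, h • TensorAlgebra.ι k v = TensorAlgebra.ι k (ρ h v)) :
    IsStable H (LinearMap.range (TensorAlgebra.ι k : V →ₗ[k] TensorAlgebra k V)) := by
  rintro h _ ⟨v, rfl⟩
  exact ⟨ρ h v, (hι h v).symm⟩

variable (μ : CounitalTwoCocycle k H) [IsScalarTower k H (TensorAlgebra k V)]
variable [IsModuleAlgebra k H (TensorAlgebra k V)]

/-- The algebra map from `T(V)` to its twist that extends the identity of `V`. -/
def toTwistTensorAlgebra : TensorAlgebra k V →ₐ[k] DrinfeldTwist μ (TensorAlgebra k V) :=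
  TensorAlgebra.lift k ((toTwist μ).toLinearMap ∘ₗ TensorAlgebra.ι k)

theorem toTwistTensorAlgebra_ι (v : V) :
    toTwistTensorAlgebra μ (TensorAlgebra.ι k v) = toTwist μ (TensorAlgebra.ι k v) := by
  rw [toTwistTensorAlgebra, TensorAlgebra.lift_ι_apply]
  rfl

theorem map_toTwistTensorAlgebra_pow
    (hι : ∀ (h : H) v, h • TensorAlgebra.ι k v = TensorAlgebra.ι k (ρ h v)) (n : ℕ) :
    (LinearMap.range (TensorAlgebra.ι k : V →ₗ[k] TensorAlgebra k V) ^ n).map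
        (toTwistTensorAlgebra μ).toLinearMap =
      (LinearMap.range (TensorAlgebra.ι k : V →ₗ[k] TensorAlgebra k V) ^ n).map
        (toTwist μ).toLinearMap := by
  rw [map_toTwist_pow μ (isStable_range_ι hι), Submodule.map_pow, ← LinearMap.range_comp,
    ← LinearMap.range_comp]
  congr 2
  ext v
  exact toTwistTensorAlgebra_ι μ v

/-- `T(V)` is isomorphic to its twist: the map is onto in each degree, and the degrees are
finite-dimensional. -/
theorem toTwistTensorAlgebra_bijective [FiniteDimensional k V]
    (hι : ∀ (h : H) v, h • TensorAlgebra.ι k v = TensorAlgebra.ι k (ρ h v)) :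
    Function.Bijective (toTwistTensorAlgebra (V := V) μ) := by
  have hT := tensorAlgebra_isInternal (k := k) (V := V)
  set E := LinearMap.range (TensorAlgebra.ι k : V →ₗ[k] TensorAlgebra k V) with hE
  have hmap := map_toTwistTensorAlgebra_pow μ hι
  constructor
  · let g : TensorAlgebra k V →ₗ[k] TensorAlgebra k V :=
      (toTwist μ).symm.toLinearMap ∘ₗ (toTwistTensorAlgebra μ).toLinearMap
    have hgmap (n : ℕ) : (E ^ n).map g = E ^ n := by
      rw [Submodule.map_comp, hmap, ← Submodule.map_comp]
      exact Submodule.map_id _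
    have hg (n : ℕ) (t) (ht : t ∈ E ^ n) : g t ∈ E ^ n :=
      (hgmap n).le (Submodule.mem_map_of_mem ht)
    have hinj : Function.Injective g := by
      refine injective_of_degreewise hT g hg fun n t ht h0 => ?_
      have : FiniteDimensional k (E ^ n : Submodule k (TensorAlgebra k V)) :=
        Module.Finite.iff_fg.2 ((Module.Finite.iff_fg.1 inferInstance : E.FG).pow n)
      have hsurj : Function.Surjective (g.restrict (hg n)) := by
        rintro ⟨y, hy⟩
        obtain ⟨x, hx, rfl⟩ := (hgmap n).ge hy
        exact ⟨⟨x, hx⟩, rfl⟩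
      have := (injective_iff_map_eq_zero _).1 (LinearMap.injective_iff_surjective.2 hsurj) ⟨t, ht⟩
        (Subtype.ext h0)
      exact congrArg Subtype.val this
    exact hinj
  · suffices LinearMap.range (toTwistTensorAlgebra (V := V) μ).toLinearMap = ⊤ from
      LinearMap.range_eq_top.1 this
    rw [LinearMap.range_eq_map, ← hT.submodule_iSup_eq_top, Submodule.map_iSup]
    rw [iSup_congr hmap, ← Submodule.map_iSup, hT.submodule_iSup_eq_top, Submodule.map_top, LinearEquiv.range]

/-- The isomorphism of `T(V)` with its twist sends `μ ▷ r` to `r`. -/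
theorem toTwistTensorAlgebra_tensorSquare
    (hι : ∀ (h : H) v, h • TensorAlgebra.ι k v = TensorAlgebra.ι k (ρ h v)) (r : V ⊗[k] V) :
    toTwistTensorAlgebra μ (tensorSquare k V (tensorAction ρ ρ (μ.val : H ⊗[k] H) r)) =
      toTwist μ (tensorSquare k V r) := by
  induction r with
  | zero => simp
  | add r s hr hs => simp only [map_add, hr, hs]
  | tmul v w =>
    have key (z : H ⊗[k] H) :
        toTwistTensorAlgebra μ (tensorSquare k V (tensorAction ρ ρ z (v ⊗ₜ w))) =
        toTwist μ (LinearMap.mul' k _ (act₂ k H (TensorAlgebra k V) (↑μ.val⁻¹)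
          (act₂ k H (TensorAlgebra k V) z (TensorAlgebra.ι k v ⊗ₜ TensorAlgebra.ι k w)))) := by
      induction z with
      | zero => simp
      | add z z' hz hz' => simp only [map_add, LinearMap.add_apply, hz, hz']
      | tmul h g =>
        simp only [tensorAction_tmul, Algebra.lsmul_coe, hι]
        change toTwistTensorAlgebra μ (TensorAlgebra.ι k (ρ h v) * TensorAlgebra.ι k (ρ g w)) = _
        rw [map_mul, toTwistTensorAlgebra_ι, toTwistTensorAlgebra_ι]
        rfl
    rw [key, ← Module.End.mul_apply, ← map_mul, Units.inv_mul, map_one]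
    rfl

variable {A : Type v} [Ring A] [Algebra k A] [Module H A] [IsScalarTower k H A]
variable [IsModuleAlgebra k H A]

/-- The algebra map `T(V) → A` that extends an equivariant map `V → A` is equivariant. -/
theorem lift_smul (hι : ∀ (h : H) v, h • TensorAlgebra.ι k v = TensorAlgebra.ι k (ρ h v))
    {j : V →ₗ[k] A} (hj : ∀ (h : H) v, j (ρ h v) = h • j v) (h : H) (t : TensorAlgebra k V) :
    TensorAlgebra.lift k j (h • t) = h • TensorAlgebra.lift k j t := by
  induction t using TensorAlgebra.induction generalizing h with
  | algebraMap c =>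
    rw [AlgHom.commutes, Algebra.algebraMap_eq_smul_one, Algebra.algebraMap_eq_smul_one,
      smul_comm h c, smul_comm h c, IsModuleAlgebra.smul_one_eq (k := k) h,
      IsModuleAlgebra.smul_one_eq (k := k) h]
    simp
  | ι v => rw [hι, TensorAlgebra.lift_ι_apply, TensorAlgebra.lift_ι_apply, hj]
  | mul s t hs ht =>
    rw [map_mul, IsModuleAlgebra.smul_mul_eq (k := k) h, IsModuleAlgebra.smul_mul_eq (k := k) h]
    generalize Coalgebra.comul (R := k) h = z
    induction z with
    | zero => simp
    | add z z' hz hz' => simp only [map_add, LinearMap.add_apply, hz, hz']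
    | tmul a b =>
      simp only [tensorAction_tmul, LinearMap.mul'_apply, map_mul, Algebra.lsmul_coe, hs, ht]
  | add s t hs ht => simp only [smul_add, map_add, hs, ht]

/-- The quadratic presentation of a twist, for a given module algebra structure on `T(V)` that
extends the action on `V`. -/
theorem IsQuadraticPresentation.twist_of_action [FiniteDimensional k V]
    (hι : ∀ (h : H) v, h • TensorAlgebra.ι k v = TensorAlgebra.ι k (ρ h v))
    {j : V →ₗ[k] A} (hj : ∀ (h : H) v, j (ρ h v) = h • j v) {R : Submodule k (V ⊗[k] V)}
    (hR : IsQuadraticPresentation j R) :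
    IsQuadraticPresentation ((toTwist μ).toLinearMap ∘ₗ j)
      (R.map (tensorAction ρ ρ (μ.val : H ⊗[k] H))) := by
  obtain ⟨hsurj, hker⟩ := hR
  have hp := lift_smul hι hj
  have hΨ := toTwistTensorAlgebra_bijective μ hι
  have hlift : TensorAlgebra.lift k ((toTwist μ).toLinearMap ∘ₗ j) =
      (twistAlgHom μ (TensorAlgebra.lift k j) hp).comp (toTwistTensorAlgebra μ) := by
    refine TensorAlgebra.hom_ext (LinearMap.ext fun v => ?_)
    change TensorAlgebra.lift k _ (TensorAlgebra.ι k v) =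
      twistAlgHom μ _ hp (toTwistTensorAlgebra μ (TensorAlgebra.ι k v))
    rw [TensorAlgebra.lift_ι_apply, toTwistTensorAlgebra_ι μ v]
    exact congrArg (toTwist μ (A := A)) (TensorAlgebra.lift_ι_apply j v).symm
  have happly (t : TensorAlgebra k V) : TensorAlgebra.lift k ((toTwist μ).toLinearMap ∘ₗ j) t =
      toTwist μ (TensorAlgebra.lift k j ((toTwist μ).symm (toTwistTensorAlgebra μ t))) :=
    DFunLike.congr_fun hlift t
  set R' := R.map (tensorSquare k V) with hR'
  have hmem (t : TensorAlgebra k V) : TensorAlgebra.lift k j t = 0 ↔ t ∈ ⊤ * R' * ⊤ := by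
    rw [← mem_twoSidedIdeal_span_iff, hR', Submodule.map_coe, ← hker, TwoSidedIdeal.mem_ker]
  -- `R'` is the degree two component of the kernel, and both are stable.
  have hstab : IsStable H R' := by
    intro h x hx
    have h2 := map_tensorSquare_le R hx
    refine mem_of_mem_degree_two R' (map_tensorSquare_le R) ?_ ((isStable_range_ι hι).pow 2 h x h2)
    have hx' : TensorAlgebra.lift k j x = 0 := by
      have : x ∈ TwoSidedIdeal.ker (TensorAlgebra.lift k j) := by
        rw [hker]
        exact TwoSidedIdeal.subset_span hx
      rwa [TwoSidedIdeal.mem_ker] at this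
    rw [← hmem, hp, hx', smul_zero]
  refine ⟨fun a => ?_, ?_⟩
  · obtain ⟨t, ht⟩ := hsurj ((toTwist μ).symm a)
    obtain ⟨s, hs⟩ := hΨ.2 (toTwist μ t)
    refine ⟨s, ?_⟩
    rw [happly, hs, LinearEquiv.symm_apply_apply, ht, LinearEquiv.apply_symm_apply]
  · set R'' := (R.map (tensorAction ρ ρ (μ.val : H ⊗[k] H))).map (tensorSquare k V) with hR''
    have hmapR : R''.map (toTwistTensorAlgebra μ).toLinearMap = R'.map (toTwist μ).toLinearMap := by
      rw [hR'', hR', ← Submodule.map_comp, ← Submodule.map_comp, ← Submodule.map_comp]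
      congr 1
      exact LinearMap.ext (toTwistTensorAlgebra_tensorSquare μ hι)
    have hmapTop : (⊤ : Submodule k (TensorAlgebra k V)).map (toTwistTensorAlgebra μ).toLinearMap =
        (⊤ : Submodule k (TensorAlgebra k V)).map (toTwist μ).toLinearMap := by
      rw [Submodule.map_top, Submodule.map_top, LinearEquiv.range]
      exact LinearMap.range_eq_top.2 hΨ.2
    have hideal : (⊤ * R'' * ⊤).map (toTwistTensorAlgebra μ).toLinearMap =
        (⊤ * R' * ⊤).map (toTwist μ).toLinearMap := by
      rw [Submodule.map_mul, Submodule.map_mul, map_toTwist_mul μ (isStable_top.mul hstab)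
        isStable_top, map_toTwist_mul μ isStable_top hstab, hmapR, hmapTop]
    ext t
    rw [← Submodule.map_coe, mem_twoSidedIdeal_span_iff, TwoSidedIdeal.mem_ker, happly,
      LinearEquiv.map_eq_zero_iff, hmem, ← Submodule.mem_map_equiv, ← hideal]
    exact hΨ.1.mem_set_image (s := ((⊤ * R'' * ⊤ : Submodule k (TensorAlgebra k V)) : Set _))

end Quadratic

section QuadraticTwist

variable {k : Type u} [Field k] {H : Type w} [Ring H] [HopfAlgebra k H]
variable {V : Type v} [AddCommGroup V] [Module k V]
variable {A : Type v} [Ring A] [Algebra k A] [Module H A] [IsScalarTower k H A]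
variable [IsModuleAlgebra k H A]

theorem IsQuadraticPresentation.twist [FiniteDimensional k V] (μ : CounitalTwoCocycle k H)
    {ρ : H →ₐ[k] Module.End k V} {j : V →ₗ[k] A} (hj : ∀ (h : H) v, j (ρ h v) = h • j v)
    {R : Submodule k (V ⊗[k] V)} (hR : IsQuadraticPresentation j R) :
    IsQuadraticPresentation ((toTwist μ).toLinearMap ∘ₗ j)
      (R.map (tensorAction ρ ρ (μ.val : H ⊗[k] H))) := by
  let _ := tensorAlgebraModule ρ
  have := tensorAlgebra_isScalarTower ρ
  have := tensorAlgebra_isModuleAlgebra ρ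
  exact hR.twist_of_action μ (fun h v => tensorAlgebraConv_ι ρ v h) hj

end QuadraticTwist

end KoszulTwist

end

open KoszulTwist
theorem mainTheorem2 {k : Type*} [Field k] {H : Type*} [Ring H] [HopfAlgebra k H]
    {A : Type*} [Ring A] [Algebra k A] [Module H A] [IsScalarTower k H A]
    [IsModuleAlgebra k H A] (𝒜 : ℕ → Submodule k A)
    (hdeg : ∀ (i : ℕ) (h : H), ∀ a ∈ 𝒜 i, h • a ∈ 𝒜 i)
    (R : Submodule k (𝒜 1 ⊗[k] 𝒜 1))
    (hR : IsQuadraticPresentation (𝒜 1).subtype R)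
    (hA : IsKoszul 𝒜)
    (μ : CounitalTwoCocycle k H) :
    IsKoszul (twistGrading μ 𝒜) ∧
    IsQuadraticPresentation ((toTwist μ).toLinearMap ∘ₗ (𝒜 1).subtype)
      (R.map (tensorAction (restrictedAction (𝒜 1) (hdeg 1)) (restrictedAction (𝒜 1) (hdeg 1))
        (μ.val : H ⊗[k] H))) := by
  have := hA.1.finite 1
  exact ⟨hA.twist μ hdeg, hR.twist μ fun _ _ => rfl⟩
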